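/- Let $P(\lambda)=P_m\lambda^m+\cdots+P_1\lambda+P_0$ be an $n\times n$ complex matrix polynomial with $\det P_m\neq 0$, and let $w_0,\dots,w_m$ be real weights with $w_0>0$ and $w_j\ge 0$ for $1\le j\le m$. For $\varepsilon>0$ let $$\Lambda_\varepsilon(P)=\Big\{\mu\in\mathbb{C} : \det\Big(\sum_{j=0}^m (P_j+\Delta_j)\mu^j\Big)=0 \text{ for some } \Delta_0,\dots,\Delta_m\in\mathbb{C}^{n\times n} \text{ with } \|\Delta_j\|\le \varepsilon w_j \text{ for all } j\Big\},$$ where $\|\cdot\|$ is the spectral matrix norm (the operator norm subordinate to the Euclidean vector norm). Suppose that $\Lambda_\varepsilon(P)\neq\mathbb{C}$. Then: (a) The boundary $\partial\Lambda_\varepsilon(P)$ lies on a real algebraic plane curve, i.e. there is a nonconstant polynomial $f\in\mathbb{R}[x,y]$ with $f(x,y)=0$ for all $x+iy\in\partial\Lambda_\varepsilon(P)$. (b) $\partial\Lambda_\varepsilon(P)$ is a piecewise $C^\infty$ curve which intersects itself at only finitely many points: it is the union of finitely many (possibly no) arcs $\gamma_k:I_k\to\mathbb{C}$, where either $I_k=[0,1]$,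 or $I_k=[0,\infty)$ and $|\gamma_k(t)|\to\infty$ as $t\to\infty$; each $\gamma_k$ is $C^\infty$ on $I_k$ (endpoints included) with nonvanishing derivative in the interior of $I_k$; and only finitely many points of $\mathbb{C}$ are of the form $\gamma_k(s)=\gamma_l(t)$ with $s\in I_k$, $t\in I_l$, $(k,s)\neq(l,t)$. (c) $\partial\Lambda_\varepsilon(P)$ has a tangent at all but finitely many of its points. Here a set $S\subseteq\mathbb{C}$ has a tangent at $z$ if the set of all limits of $c_i d_i$, with $c_i\in\mathbb{R}$, $z+d_i\in S$ and $d_i\to 0$, is a line $\mathbb{R}u$ with $u\ne 0$. -/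

import Mathlib

open scoped ContDiff

noncomputable section

/-- The value `P(μ) = P_m μ^m + ⋯ + P_1 μ + P_0` at `μ` of the `n × n` matrix polynomial with
coefficients `P_0, …, P_m`. -/
def matrixPolyEval {m n : ℕ} (P : Fin (m + 1) → Matrix (Fin n) (Fin n) ℂ) (μ : ℂ) :
    Matrix (Fin n) (Fin n) ℂ :=
  ∑ j : Fin (m + 1), μ ^ (j : ℕ) • P j

/-- The spectral matrix norm, i.e. the operator norm subordinate to the Euclidean vector norm. -/
def spectralNorm₂ {n : ℕ} (A : Matrix (Fin n) (Fin n) ℂ) : ℝ :=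
  ‖Matrix.toEuclideanCLM (n := Fin n) (𝕜 := ℂ) A‖

/-- The class `𝓑(P, ε, w)` of admissible perturbations of `P`: all `Q = P + Δ` (given by their
coefficients) with `‖Δ_j‖ ≤ ε w_j` for `j = 0, …, m`. -/
def admissiblePerturbations {m n : ℕ} (P : Fin (m + 1) → Matrix (Fin n) (Fin n) ℂ) (ε : ℝ)
    (w : Fin (m + 1) → ℝ) : Set (Fin (m + 1) → Matrix (Fin n) (Fin n) ℂ) :=
  {Q | ∀ j, spectralNorm₂ (Q j - P j) ≤ ε * w j}

/-- The `ε`-pseudospectrum `Λ_ε(P)` with respect to the weights `w_0, …, w_m`. -/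
def pseudospectrum {m n : ℕ} (P : Fin (m + 1) → Matrix (Fin n) (Fin n) ℂ) (ε : ℝ)
    (w : Fin (m + 1) → ℝ) : Set ℂ :=
  {μ | ∃ Q ∈ admissiblePerturbations P ε w, (matrixPolyEval Q μ).det = 0}

/-- A real algebraic curve in the plane `ℂ = ℝ²`: the zero set of a nonconstant real polynomial
in the two real coordinates. -/
def IsRealAlgebraicPlaneCurve (C : Set ℂ) : Prop :=
  ∃ f : MvPolynomial (Fin 2) ℝ, 0 < f.totalDegree ∧
    C = {z : ℂ | MvPolynomial.eval ![z.re, z.im] f = 0}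

/-- A closed `C^∞` arc in the plane: either a compact one, parametrised by `[0, 1]`, or one that
goes off to infinity, parametrised by `[0, ∞)`. The parametrisation is `C^∞` up to and including
the endpoints and regular (nonvanishing derivative) between them. -/
structure SmoothPlaneArc where
  /-- the parametrisation; only its values on `dom` matter -/
  toFun : ℝ → ℂ
  /-- the parameter interval -/
  dom : Set ℝ
  dom_eq : dom = Set.Icc 0 1 ∨
    (dom = Set.Ici 0 ∧ Filter.Tendsto toFun Filter.atTop (Bornology.cobounded ℂ))
  contDiffOn : ContDiffOn ℝ ∞ toFun dom
  deriv_ne_zero : ∀ t ∈ interior dom, deriv toFun t ≠ 0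

/-- The finite family `γ` of smooth arcs presents `S` as a piecewise `C^∞` curve: `S` is the union
of the arcs. -/
def IsPiecewiseSmoothPresentation (S : Set ℂ) {h : ℕ} (γ : Fin h → SmoothPlaneArc) : Prop :=
  S = ⋃ k, (γ k).toFun '' (γ k).dom

/-- The points where the piecewise smooth curve made up of the arcs `γ` meets itself: those
that are attained at two different parameters, on one arc or on two different arcs (common
endpoints of arcs count as well). -/
def selfIntersections {h : ℕ} (γ : Fin h → SmoothPlaneArc) : Set ℂ :=
  {z | ∃ k l : Fin h, ∃ s ∈ (γ k).dom, ∃ t ∈ (γ l).dom,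
    (k, s) ≠ (l, t) ∧ (γ k).toFun s = z ∧ (γ l).toFun t = z}

/-- The plane set `S` has a tangent (line) at `z`: its tangent directions at `z`, i.e. the limits
of `c_i • d_i` with `c_i` real, `z + d_i ∈ S` and `d_i → 0`, form a line. -/
def HasTangentLineAt (S : Set ℂ) (z : ℂ) : Prop :=
  ∃ u : ℂ, u ≠ 0 ∧ tangentConeAt ℝ S z = {v : ℂ | ∃ c : ℝ, v = c • u}

end

/-! The theorem splits into a topological fact, an equation, and a structure result for real plane
curves.

Topology. A point z lies in the pseudospectrum iff ‖P(z)v‖ ≤ ε q(|z|) for some unit vector v, where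
q has coefficients w_j (`mem_pseudospectrum_iff`). The maximum modulus principle, applied to an
entry of P(z)⁻¹ times a polynomial that attains q(|z|) at the point considered, shows that the
pseudospectrum is the closure of its interior. Hence its boundary separates the interior from the
complement, and every boundary point is approached from both sides
(`isSeparating_frontier_pseudospectrum`).

Equation. On the boundary det(P(z)*P(z) - ε²q(|z|)²I) = 0. The left side has the form a + |z|b with
polynomials a, b in x, y. Multiplying by a - |z|b removes |z|, and the product is not the zero
polynomial because x² + c² is not a square in ℂ[x] for c ≠ 0.

Structure. After a linear change of coordinates and removal of repeated factors, the curve is g(x,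
y) = 0 with g monic in y and with simple roots over all but finitely many x. Between exceptional
abscissas the zero set is a finite union of disjoint graphs, and a separating subset contains each
graph entirely or misses it (`IsSeparating.forall_mem_or_forall_notMem`). Near an exceptional
abscissa c a branch may behave like a fractional power of x - c. The substitution x = c + ρ exp(1 -
1/t) makes it smooth up to t = 0, because all derivatives in s = 1/t - 1 decay exponentially. This
replaces Puiseux series and rests on one fact: polynomials have eventually constant sign along a
branch (`IsCurveEnd.exists_sign`), so derivatives of every order are eventually monotone.
Self-intersections and points without a tangent then lie over finitely many abscissas. -/

/-! ### Bivariate polynomials: calculus, separable reduction, integrality. -/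

section BivariatePolynomial

open Polynomial Filter Topology
open scoped Polynomial.Bivariate

/-- The partial derivative of a bivariate polynomial in the inner variable. -/
noncomputable def xDeriv (H : ℝ[X][Y]) : ℝ[X][Y] :=
  Bivariate.swap (derivative (Bivariate.swap H))

lemma xDeriv_add (G H : ℝ[X][Y]) : xDeriv (G + H) = xDeriv G + xDeriv H := by
  simp [xDeriv]

lemma xDeriv_monomial (n : ℕ) (f : ℝ[X]) :
    xDeriv (monomial n f) = monomial n (derivative f) := by
  rw [xDeriv, Bivariate.swap_monomial, derivative_mul, derivative_C, mul_zero, add_zero,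
    derivative_map, ← Bivariate.swap_monomial, Bivariate.swap_swap_apply]

lemma evalEval_monomial (x y : ℝ) (n : ℕ) (f : ℝ[X]) :
    (monomial n f).evalEval x y = f.eval x * y ^ n := by
  simp [evalEval]

lemma contDiff_evalEval (H : ℝ[X][Y]) :
    ContDiff ℝ ∞ fun v : ℝ × ℝ ↦ H.evalEval v.1 v.2 := by
  induction H using Polynomial.induction_on' with
  | add p q hp hq => simpa only [evalEval_add] using hp.add hq
  | monomial n f =>
    simp only [evalEval_monomial]
    have : ContDiff ℝ ∞ fun x : ℝ ↦ f.eval x := by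
      simpa [coe_aeval_eq_eval] using f.contDiff_aeval (𝕜 := ℝ) ∞
    exact (this.comp contDiff_fst).mul (contDiff_snd.pow n)

lemma continuous_evalEval (H : ℝ[X][Y]) :
    Continuous fun v : ℝ × ℝ ↦ H.evalEval v.1 v.2 :=
  (contDiff_evalEval H).continuous

/-- The chain rule for a bivariate polynomial along a curve. -/
lemma hasDerivAt_evalEval (H : ℝ[X][Y]) {x y : ℝ → ℝ} {x' y' t : ℝ}
    (hx : HasDerivAt x x' t) (hy : HasDerivAt y y' t) :
    HasDerivAt (fun t ↦ H.evalEval (x t) (y t))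
      ((xDeriv H).evalEval (x t) (y t) * x' + (derivative H).evalEval (x t) (y t) * y') t := by
  induction H using Polynomial.induction_on' with
  | add p q hp hq =>
    simp only [evalEval_add, xDeriv_add, derivative_add]
    refine (hp.fun_add hq).congr_deriv ?_
    ring
  | monomial n f =>
    simp only [evalEval_monomial, xDeriv_monomial, derivative_monomial]
    refine (((f.hasDerivAt (x t)).comp t hx).fun_mul (hy.fun_pow n)).congr_deriv ?_
    simp only [eval_mul, eval_natCast, Function.comp_apply]
    ring

/-- A monic bivariate polynomial can be replaced by a monic separable one without losing zeros. -/
lemma exists_monic_separable (p : ℝ[X][Y]) (hp : p.Monic) :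
    ∃ g : ℝ[X][Y], g.Monic ∧ (∀ x y, p.evalEval x y = 0 → g.evalEval x y = 0) ∧
      ∃ (u v : ℝ[X][Y]) (d : ℝ[X]), d ≠ 0 ∧ g * u + derivative g * v = C d := by
  classical
  let K := FractionRing ℝ[X]
  let P : K[X] := p.map (algebraMap ℝ[X] K)
  have hP : P.Monic := hp.map _
  let r : K[X] := UniqueFactorizationMonoid.radical P
  have hr0 : r ≠ 0 := UniqueFactorizationMonoid.radical_ne_zero
  -- Gauss's lemma: up to a constant, a factor over ℝ(x) of a monic polynomial has coefficients in
  -- ℝ[x].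
  obtain ⟨g, hg⟩ := IsIntegrallyClosed.eq_map_mul_C_of_dvd K hp
    (UniqueFactorizationMonoid.radical_dvd_self (a := P))
  change _ * C r.leadingCoeff = r at hg
  have hlc : r.leadingCoeff ≠ 0 := leadingCoeff_ne_zero.mpr hr0
  have hu : IsUnit (C r.leadingCoeff) := isUnit_C.mpr hlc.isUnit
  have hgm : g.Monic := by
    have h1 := congrArg leadingCoeff hg
    rw [leadingCoeff_mul, leadingCoeff_C, mul_eq_right₀ hlc,
      leadingCoeff_map_of_injective (IsFractionRing.injective ℝ[X] K)] at h1
    exact IsFractionRing.injective ℝ[X] K (by rw [h1, map_one])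
  have hassoc : Associated (g.map (algebraMap ℝ[X] K)) r := by
    rw [← hg]; exact (associated_mul_unit_right _ _ hu)
  have hsep : (g.map (algebraMap ℝ[X] K)).Separable := by
    rw [PerfectField.separable_iff_squarefree]
    have : Squarefree r := UniqueFactorizationMonoid.squarefree_radical
    exact this.squarefree_of_dvd hassoc.dvd
  refine ⟨g, hgm, ?_, ?_⟩
  · obtain ⟨N, hN⟩ := UniqueFactorizationMonoid.exists_dvd_radical_self_pow hP.ne_zero
    have h2 : P ∣ (g ^ N).map (algebraMap ℝ[X] K) := by
      rw [Polynomial.map_pow]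
      exact hN.trans (hassoc.symm.pow_pow).dvd
    have h3 : p ∣ g ^ N := (Monic.dvd_iff_fraction_map_dvd_fraction_map (K := K) (hgm.pow N) hp).mp h2
    intro x y hxy
    have h4 := evalEval_dvd x y h3
    rw [hxy, zero_dvd_iff, evalEval_pow] at h4
    exact eq_zero_of_pow_eq_zero h4
  · by_cases h0 : g.natDegree = 0
    · have : g = 1 := eq_one_of_monic_natDegree_zero hgm h0
      exact ⟨1, 0, 1, one_ne_zero, by simp [this]⟩
    -- Here d is the resultant of g and its y-derivative. It is nonzero because g is separable over
    -- ℝ(x).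
    obtain ⟨u, v, -, -, huv⟩ := exists_mul_add_mul_eq_C_resultant g (derivative g) le_rfl le_rfl
      (Or.inl h0)
    refine ⟨u, v, _, ?_, huv⟩
    intro hres
    have h5 := resultant_map_map (f := g) (g := derivative g) (m := g.natDegree)
      (n := (derivative g).natDegree) (algebraMap ℝ[X] K)
    rw [hres, map_zero] at h5
    have h6 : resultant (g.map (algebraMap ℝ[X] K)) (derivative (g.map (algebraMap ℝ[X] K))) ≠ 0 := by
      rw [Ne, resultant_eq_zero_iff]
      exact fun h ↦ h.2 hsep
    apply h6
    rw [derivative_map, natDegree_map_eq_of_injective (IsFractionRing.injective ℝ[X] K),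
      natDegree_map_eq_of_injective (IsFractionRing.injective ℝ[X] K)]
    exact h5

/-- A polynomial function on a monic algebraic curve is integral over the polynomials in `x`. -/
lemma exists_integral_relation (g : ℝ[X][Y]) (hg : g.Monic) (H : ℝ[X][Y]) :
    ∃ q : ℝ[X][Y], q.Monic ∧
      ∀ x y, g.evalEval x y = 0 → q.evalEval x (H.evalEval x y) = 0 := by
  -- As g is monic, the coordinate ring of the curve is a finite ℝ[x]-module, so the class of H
  -- satisfies a monic equation, which can be evaluated at points of the curve.
  have : Module.Finite ℝ[X] (AdjoinRoot g) := hg.finite_adjoinRoot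
  obtain ⟨q, hq, hq0⟩ := Algebra.IsIntegral.isIntegral (R := ℝ[X]) (AdjoinRoot.mk g H)
  refine ⟨q, hq, fun x y hxy ↦ ?_⟩
  have h1 := congrArg (AdjoinRoot.evalEval hxy) hq0
  rw [hom_eval₂, map_zero] at h1
  have h2 : (AdjoinRoot.evalEval hxy).comp (algebraMap ℝ[X] (AdjoinRoot g)) = evalRingHom x := by
    refine RingHom.ext fun r ↦ ?_
    rw [RingHom.comp_apply, AdjoinRoot.algebraMap_eq, ← AdjoinRoot.mk_C, AdjoinRoot.evalEval_mk,
      evalEval_C, coe_evalRingHom]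
  rw [h2, AdjoinRoot.evalEval_mk, eval₂_evalRingHom] at h1
  exact h1

/-- The real roots of `g(x, ·)`. -/
noncomputable def fiberRoots (g : ℝ[X][Y]) (x : ℝ) : Finset ℝ :=
  (g.map (evalRingHom x)).roots.toFinset

lemma mem_fiberRoots {g : ℝ[X][Y]} (hg : g.Monic) {x y : ℝ} :
    y ∈ fiberRoots g x ↔ g.evalEval x y = 0 := by
  rw [fiberRoots, Multiset.mem_toFinset, mem_roots (hg.map _).ne_zero, IsRoot,
    map_evalRingHom_eval]

end BivariatePolynomial

/-! ### Local and global root branches of a monic polynomial. -/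

section Branches

open Polynomial Filter Topology Set
open scoped Polynomial.Bivariate

/-- The real roots of a monic bivariate polynomial are locally bounded. -/
lemma exists_continuous_root_bound {g : ℝ[X][Y]} (hg : g.Monic) :
    ∃ B : ℝ → ℝ, Continuous B ∧ ∀ x y, g.evalEval x y = 0 → |y| ≤ B x := by
  set N := g.natDegree with hN
  -- Cauchy's bound for the roots of a monic polynomial.
  refine ⟨fun x ↦ 1 + ∑ i ∈ Finset.range N, |(g.coeff i).eval x|, ?_, ?_⟩
  · refine continuous_const.add (continuous_finsetSum _ fun i _ ↦ ?_)
    exact (g.coeff i).continuous.abs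
  · intro x y hxy
    have hS : 0 ≤ ∑ i ∈ Finset.range N, |(g.coeff i).eval x| :=
      Finset.sum_nonneg fun i _ ↦ abs_nonneg _
    rcases le_or_gt |y| 1 with h1 | h1
    · linarith
    by_contra! hlt
    have hsum : y ^ N = -∑ i ∈ Finset.range N, (g.coeff i).eval x * y ^ i := by
      have h2 : g.evalEval x y = ∑ i ∈ Finset.range (N + 1), (g.coeff i).eval x * y ^ i := by
        rw [evalEval, eval_eq_sum_range (p := g), eval_finsetSum]
        simp [hN]
      rw [Finset.sum_range_succ, hxy, hN, hg.coeff_natDegree] at h2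
      simp only [eval_one, one_mul] at h2
      linarith
    have hN0 : N ≠ 0 := by
      intro h0
      rw [h0] at hsum
      simp at hsum
    have h3 : |y| ^ N ≤ (∑ i ∈ Finset.range N, |(g.coeff i).eval x|) * |y| ^ (N - 1) := by
      rw [← abs_pow, hsum, abs_neg, Finset.sum_mul]
      refine (Finset.abs_sum_le_sum_abs _ _).trans (Finset.sum_le_sum fun i hi ↦ ?_)
      rw [abs_mul, abs_pow]
      have : i ≤ N - 1 := by have := Finset.mem_range.mp hi; omega
      gcongr
      exact h1.le
    have h4 : |y| ^ N = |y| * |y| ^ (N - 1) := by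
      rw [← pow_succ', Nat.sub_add_cancel (Nat.one_le_iff_ne_zero.mpr hN0)]
    have h5 : 0 < |y| ^ (N - 1) := by positivity
    rw [h4] at h3
    have := le_of_mul_le_mul_right h3 h5
    linarith

/-- Near a simple root the real zero set is the graph of a differentiable function. -/
lemma exists_local_root (g : ℝ[X][Y]) {x₀ y₀ : ℝ} (h0 : g.evalEval x₀ y₀ = 0)
    (h1 : (derivative g).evalEval x₀ y₀ ≠ 0) :
    ∃ ψ : ℝ → ℝ, ψ x₀ = y₀ ∧ (∀ᶠ x in 𝓝 x₀, g.evalEval x (ψ x) = 0) ∧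
      (∀ᶠ v : ℝ × ℝ in 𝓝 (x₀, y₀), g.evalEval v.1 v.2 = 0 → v.2 = ψ v.1) ∧
      HasDerivAt ψ (-(xDeriv g).evalEval x₀ y₀ / (derivative g).evalEval x₀ y₀) x₀ := by
  set F : ℝ × ℝ → ℝ := fun v ↦ g.evalEval v.1 v.2 with hF
  have hs : HasStrictFDerivAt F (fderiv ℝ F (x₀, y₀)) (x₀, y₀) :=
    (contDiff_evalEval g).contDiffAt.hasStrictFDerivAt (by simp)
  have hy : (fderiv ℝ F (x₀, y₀)) (0, 1) = (derivative g).evalEval x₀ y₀ := by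
    have h2 : HasDerivAt (fun t : ℝ ↦ ((x₀, t) : ℝ × ℝ)) (0, 1) y₀ :=
      (hasDerivAt_const y₀ x₀).prodMk (hasDerivAt_id y₀)
    have h3 := (hs.hasFDerivAt.comp_hasDerivAt y₀ h2)
    have h4 := hasDerivAt_evalEval g (hasDerivAt_const y₀ x₀) (hasDerivAt_id y₀)
    simpa using h3.unique h4
  have hinv : ((fderiv ℝ F (x₀, y₀)) ∘L .inr ℝ ℝ ℝ).IsInvertible := by
    refine ⟨ContinuousLinearEquiv.unitsEquivAut ℝ (Units.mk0 _ h1), ?_⟩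
    ext
    simp [hy]
  set ψ := hs.implicitFunctionOfProdDomain hinv with hψ
  have hval := hs.eventually_apply_eq_iff_implicitFunctionOfProdDomain hinv
  have hev := hs.eventually_apply_implicitFunctionOfProdDomain hinv
  have hψ0 : ψ x₀ = y₀ := hval.self_of_nhds.mp rfl
  have hF0 : F (x₀, y₀) = 0 := h0
  rw [hF0] at hev hval
  refine ⟨ψ, hψ0, hev, hval.mono fun v hv h ↦ (hv.mp h).symm, ?_⟩
  obtain ⟨c, hc⟩ : ∃ c, HasDerivAt ψ c x₀ :=
    ⟨_, (hs.hasStrictFDerivAt_implicitFunctionOfProdDomain hinv).hasFDerivAt.hasDerivAt⟩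
  -- The slope is found by differentiating the identity g(x, ψ x) = 0.
  have h5 := hasDerivAt_evalEval g (hasDerivAt_id x₀) hc
  have h6 : HasDerivAt (fun t ↦ g.evalEval (id t) (ψ t)) 0 x₀ :=
    (hasDerivAt_const x₀ (0 : ℝ)).congr_of_eventuallyEq hev
  have h7 := h5.unique h6
  simp only [id, hψ0, mul_one] at h7
  convert hc using 1
  field_simp
  linarith

/-- The `i`-th smallest real root of `g(x, ·)`, where there are exactly `k` of them. -/
noncomputable def rootBranch (g : ℝ[X][Y]) (k : ℕ) (i : Fin k) (x : ℝ) : ℝ :=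
  if h : (fiberRoots g x).card = k then (fiberRoots g x).orderEmbOfFin h i else 0

lemma rootBranch_of_card {g : ℝ[X][Y]} {k : ℕ} {x : ℝ} (h : (fiberRoots g x).card = k)
    (i : Fin k) : rootBranch g k i x = (fiberRoots g x).orderEmbOfFin h i := by
  rw [rootBranch, dif_pos h]

/-- Near a fibre with only simple roots, the roots are given by finitely many ordered local
branches. -/
lemma eventually_card_fiberRoots_eq {g : ℝ[X][Y]} (hg : g.Monic) {x₀ : ℝ}
    (hx₀ : ∀ y, g.evalEval x₀ y = 0 → (derivative g).evalEval x₀ y ≠ 0) :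
    (∀ᶠ x in 𝓝 x₀, (fiberRoots g x).card = (fiberRoots g x₀).card) ∧
    ∀ i : Fin (fiberRoots g x₀).card,
      HasDerivAt (rootBranch g (fiberRoots g x₀).card i)
        (-(xDeriv g).evalEval x₀ (rootBranch g (fiberRoots g x₀).card i x₀) /
          (derivative g).evalEval x₀ (rootBranch g (fiberRoots g x₀).card i x₀)) x₀ := by
  classical
  set k := (fiberRoots g x₀).card with hk
  set e := (fiberRoots g x₀).orderEmbOfFin hk.symm with he
  have hroot : ∀ i, g.evalEval x₀ (e i) = 0 := fun i ↦
    (mem_fiberRoots hg).mp (Finset.orderEmbOfFin_mem _ _ i)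
  choose ψ hψ0 hψ hψu hψd using fun i ↦ exists_local_root g (hroot i) (hx₀ _ (hroot i))
  -- No further roots appear nearby: the root bound confines them to a compact interval, on which
  -- each non-root of the fibre over x₀ has a root-free neighbourhood.
  have hall : ∀ᶠ x in 𝓝 x₀, ∀ y, g.evalEval x y = 0 → ∃ i, y = ψ i x := by
    obtain ⟨B, hB, hBr⟩ := exists_continuous_root_bound hg
    have h1 : ∀ᶠ x in 𝓝 x₀, B x < B x₀ + 1 :=
      hB.continuousAt.eventually_lt continuousAt_const (by linarith)
    have h2 : ∀ᶠ x in 𝓝 x₀, ∀ y ∈ Icc (-(B x₀ + 1)) (B x₀ + 1),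
        g.evalEval x y = 0 → ∃ i, y = ψ i x := by
      refine isCompact_Icc.eventually_forall_of_forall_eventually fun y _ ↦ ?_
      by_cases hy : g.evalEval x₀ y = 0
      · have : y ∈ Set.range e := by
          rw [he, Finset.range_orderEmbOfFin]
          exact (mem_fiberRoots hg).mpr hy
        obtain ⟨i, rfl⟩ := this
        filter_upwards [hψu i] with v hv h
        exact ⟨i, hv h⟩
      · have := (continuous_evalEval g).continuousAt.eventually_ne (x := (x₀, y)) hy
        filter_upwards [this] with v hv h
        exact absurd h hv
    filter_upwards [h1, h2] with x hx1 hx2 y hy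
    have := abs_le.mp ((hBr x y hy).trans hx1.le)
    exact hx2 y ⟨this.1, this.2⟩ hy
  have hmono : ∀ᶠ x in 𝓝 x₀, StrictMono fun i ↦ ψ i x := by
    have : ∀ᶠ x in 𝓝 x₀, ∀ i j, i < j → ψ i x < ψ j x := by
      rw [eventually_all]; intro i
      rw [eventually_all]; intro j
      by_cases hij : i < j
      · have : ψ i x₀ < ψ j x₀ := by
          rw [hψ0, hψ0]; exact e.strictMono hij
        filter_upwards [(hψd i).continuousAt.eventually_lt (hψd j).continuousAt this] with x hx _
        exact hx
      · exact Eventually.of_forall fun _ h ↦ absurd h hij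
    filter_upwards [this] with x hx i j hij using hx i j hij
  have hzero : ∀ᶠ x in 𝓝 x₀, ∀ i, g.evalEval x (ψ i x) = 0 := eventually_all.mpr hψ
  have hcard : ∀ᶠ x in 𝓝 x₀, (fiberRoots g x).card = k := by
    filter_upwards [hall, hmono, hzero] with x h1 h2 h3
    have : fiberRoots g x = Finset.univ.image fun i ↦ ψ i x := by
      ext y
      rw [mem_fiberRoots hg, Finset.mem_image]
      constructor
      · intro hy
        obtain ⟨i, hi⟩ := h1 y hy
        exact ⟨i, Finset.mem_univ _, hi.symm⟩
      · rintro ⟨i, -, rfl⟩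
        exact h3 i
    rw [this, Finset.card_image_of_injective _ h2.injective, Finset.card_univ, Fintype.card_fin]
  refine ⟨hcard, fun i ↦ ?_⟩
  -- The local branches keep their order near x₀, so the i-th one is the i-th smallest root.
  have heq : rootBranch g k i =ᶠ[𝓝 x₀] ψ i := by
    filter_upwards [hcard, hmono, hzero] with x h1 h2 h3
    rw [rootBranch_of_card h1]
    have := Finset.orderEmbOfFin_unique h1 (fun j ↦ (mem_fiberRoots hg).mpr (h3 j)) h2
    exact (congrFun this i).symm
  have h0 : rootBranch g k i x₀ = e i := heq.self_of_nhds.trans (hψ0 i)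
  rw [h0]
  exact (hψd i).congr_of_eventuallyEq heq

/-- Over a connected set of parameters with only simple roots, the real zero set of a monic
bivariate polynomial is the disjoint union of finitely many graphs of differentiable functions. -/
lemma exists_branches {g : ℝ[X][Y]} (hg : g.Monic) {J : Set ℝ} (hJ : IsPreconnected J)
    (hJs : ∀ x ∈ J, ∀ y, g.evalEval x y = 0 → (derivative g).evalEval x y ≠ 0) :
    ∃ (k : ℕ) (φ : Fin k → ℝ → ℝ),
      (∀ i, ∀ x ∈ J, g.evalEval x (φ i x) = 0) ∧
      (∀ x ∈ J, ∀ y, g.evalEval x y = 0 → ∃ i, y = φ i x) ∧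
      (∀ x ∈ J, Function.Injective fun i ↦ φ i x) ∧
      ∀ i, ∀ x ∈ J, HasDerivAt (φ i)
        (-(xDeriv g).evalEval x (φ i x) / (derivative g).evalEval x (φ i x)) x := by
  rcases J.eq_empty_or_nonempty with rfl | ⟨m, hm⟩
  · exact ⟨0, fun _ _ ↦ 0, by simp⟩
  have hcard : ∀ x ∈ J, (fiberRoots g x).card = (fiberRoots g m).card := by
    intro x hx
    refine hJ.constant (f := fun x ↦ (fiberRoots g x).card) (fun z hz ↦ ?_) hx hm
    exact (continuousAt_const.congr (EventuallyEq.symm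
      (eventually_card_fiberRoots_eq hg (hJs z hz)).1)).continuousWithinAt
  refine ⟨(fiberRoots g m).card, rootBranch g _, fun i x hx ↦ ?_, fun x hx y hy ↦ ?_,
    fun x hx i j hij ↦ ?_, fun i x hx ↦ ?_⟩
  · rw [rootBranch_of_card (hcard x hx), ← mem_fiberRoots hg]
    exact Finset.orderEmbOfFin_mem _ _ i
  · have : y ∈ Set.range ((fiberRoots g x).orderEmbOfFin (hcard x hx)) := by
      rw [Finset.range_orderEmbOfFin]
      exact (mem_fiberRoots hg).mpr hy
    obtain ⟨i, rfl⟩ := this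
    exact ⟨i, (rootBranch_of_card (hcard x hx) i).symm⟩
  · simp only [rootBranch_of_card (hcard x hx)] at hij
    exact ((fiberRoots g x).orderEmbOfFin (hcard x hx)).injective hij
  · have := (eventually_card_fiberRoots_eq hg (hJs x hx)).2
    rw [hcard x hx] at this
    exact this i

end Branches

/-! ### Smooth extension by zero of exponentially decaying functions. -/

section FlatReparametrization

open Polynomial Filter Topology Set Asymptotics

/-- The auxiliary functions `p(1/t) W(1/t - 1)`, extended by zero to `t ≤ 0`. -/
noncomputable def flatExtension (p : ℝ[X]) (W : ℝ → ℝ) (t : ℝ) : ℝ :=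
  if 0 < t then p.eval t⁻¹ * W (t⁻¹ - 1) else 0

lemma flatExtension_of_pos (p : ℝ[X]) (W : ℝ → ℝ) {t : ℝ} (ht : 0 < t) :
    flatExtension p W t = p.eval t⁻¹ * W (t⁻¹ - 1) := if_pos ht

lemma flatExtension_of_nonpos (p : ℝ[X]) (W : ℝ → ℝ) {t : ℝ} (ht : t ≤ 0) :
    flatExtension p W t = 0 := if_neg ht.not_gt

lemma tendsto_eval_mul_exp_neg (p : ℝ[X]) {α : ℝ} (hα : 0 < α) :
    Tendsto (fun s ↦ p.eval s * Real.exp (-α * s)) atTop (𝓝 0) := by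
  have h1 := (p.comp (C α⁻¹ * X)).tendsto_div_exp_atTop.comp
    (tendsto_id.const_mul_atTop hα)
  refine h1.congr fun s ↦ ?_
  simp only [Function.comp_apply, id, eval_comp, eval_mul, eval_C, eval_X]
  rw [inv_mul_cancel_left₀ hα.ne', neg_mul, Real.exp_neg, div_eq_mul_inv]

/-- With s = 1/t - 1 the limit t → 0+ becomes s → ∞, where exponential decay beats the polynomial
p(s + 1). -/
lemma tendsto_flatExtension (p : ℝ[X]) {W : ℝ → ℝ} {α : ℝ} (hα : 0 < α)
    (hW : W =O[atTop] fun s ↦ Real.exp (-α * s)) :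
    Tendsto (flatExtension p W) (𝓝 0) (𝓝 0) := by
  have h1 : Tendsto (fun s ↦ p.eval (s + 1) * W s) atTop (𝓝 0) := by
    refine ((isBigO_refl (fun s ↦ p.eval (s + 1)) atTop).mul hW).trans_tendsto ?_
    have := tendsto_eval_mul_exp_neg (p.comp (X + 1)) hα
    simpa [eval_comp] using this
  have h2 : Tendsto (fun t : ℝ ↦ t⁻¹ - 1) (𝓝[>] 0) atTop :=
    tendsto_atTop_add_const_right _ _ tendsto_inv_nhdsGT_zero
  have h3 : Tendsto (flatExtension p W) (𝓝[>] 0) (𝓝 0) := by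
    refine (h1.comp h2).congr' ?_
    filter_upwards [self_mem_nhdsWithin] with t ht
    rw [flatExtension_of_pos p W ht]
    simp
  have h4 : Tendsto (flatExtension p W) (𝓝[≤] 0) (𝓝 0) := by
    refine tendsto_const_nhds.congr' ?_
    filter_upwards [self_mem_nhdsWithin] with t ht
    exact (flatExtension_of_nonpos p W ht).symm
  have := h4.sup h3
  rwa [nhdsLE_sup_nhdsGT] at this

/-- The polynomial factor p makes the family closed under differentiation, since each derivative of
1/t only produces further powers of 1/t. The bound on t says that 1/t - 1 > s₀ when t > 0. -/
lemma hasDerivAt_flatExtension (p : ℝ[X]) {W W' : ℝ → ℝ} {α s₀ t : ℝ} (hα : 0 < α)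
    (hs₀ : -1 < s₀) (hWd : ∀ s, s₀ < s → HasDerivAt W (W' s) s)
    (hW : W =O[atTop] fun s ↦ Real.exp (-α * s)) (ht : t < (1 + s₀)⁻¹) :
    HasDerivAt (flatExtension p W)
      (flatExtension (-X ^ 2 * derivative p) W t + flatExtension (-X ^ 2 * p) W' t) t := by
  rcases lt_trichotomy t 0 with h | rfl | h
  · rw [flatExtension_of_nonpos _ _ h.le, flatExtension_of_nonpos _ _ h.le, add_zero]
    refine (hasDerivAt_const t (0 : ℝ)).congr_of_eventuallyEq ?_
    filter_upwards [Iio_mem_nhds h] with s hs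
    exact flatExtension_of_nonpos p W (le_of_lt hs)
  · rw [flatExtension_of_nonpos _ _ le_rfl, flatExtension_of_nonpos _ _ le_rfl, add_zero,
      hasDerivAt_iff_tendsto_slope]
    -- The difference quotient at 0 is the same construction with p replaced by X * p, so it tends
    -- to 0.
    refine ((tendsto_flatExtension (X * p) hα hW).mono_left nhdsWithin_le_nhds).congr fun s ↦ ?_
    rw [slope_def_field, flatExtension_of_nonpos p W le_rfl, sub_zero, sub_zero]
    rcases le_or_gt s 0 with hs | hs
    · rw [flatExtension_of_nonpos _ _ hs, flatExtension_of_nonpos _ _ hs, zero_div]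
    · rw [flatExtension_of_pos _ _ hs, flatExtension_of_pos _ _ hs, eval_mul, eval_X]
      field_simp
  · rw [flatExtension_of_pos _ _ h, flatExtension_of_pos _ _ h]
    have h1 : s₀ < t⁻¹ - 1 := by
      have : 1 + s₀ < t⁻¹ := (lt_inv_comm₀ h (by linarith)).mp ht
      linarith
    have h2 : HasDerivAt (fun t : ℝ ↦ t⁻¹) (-(t ^ 2)⁻¹) t := hasDerivAt_inv h.ne'
    have h3 := ((p.hasDerivAt t⁻¹).comp t h2).fun_mul ((hWd _ h1).comp t (h2.sub_const 1))
    refine (h3.congr_of_eventuallyEq ?_).congr_deriv ?_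
    · filter_upwards [Ioi_mem_nhds h] with s hs
      exact flatExtension_of_pos p W hs
    · simp only [eval_mul, eval_neg, eval_pow, eval_X, Function.comp_apply]
      ring

/-- If all derivatives of `W` decay exponentially, then `W(1/t - 1)` extends smoothly by zero to
`t ≤ 0`. -/
lemma contDiffOn_flatExtension {W : ℕ → ℝ → ℝ} {α s₀ : ℝ} (hα : 0 < α) (hs₀ : -1 < s₀)
    (hWd : ∀ k, ∀ s, s₀ < s → HasDerivAt (W k) (W (k + 1) s) s)
    (hW : ∀ k, W k =O[atTop] fun s ↦ Real.exp (-α * s)) (p : ℝ[X]) (k : ℕ) :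
    ContDiffOn ℝ ∞ (flatExtension p (W k)) (Iio (1 + s₀)⁻¹) := by
  rw [contDiffOn_infty]
  intro n
  induction n generalizing p k with
  | zero =>
    rw [Nat.cast_zero, contDiffOn_zero]
    exact fun t ht ↦ (hasDerivAt_flatExtension p hα hs₀ (hWd k) (hW k)
      ht).continuousAt.continuousWithinAt
  | succ n ih =>
    rw [Nat.cast_succ, contDiffOn_succ_iff_deriv_of_isOpen isOpen_Iio]
    refine ⟨fun t ht ↦ (hasDerivAt_flatExtension p hα hs₀ (hWd k) (hW k)
      ht).differentiableAt.differentiableWithinAt, by simp, ?_⟩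
    refine ((ih (-X ^ 2 * derivative p) k).add (ih (-X ^ 2 * p) (k + 1))).congr fun t ht ↦ ?_
    exact (hasDerivAt_flatExtension p hα hs₀ (hWd k) (hW k) ht).deriv

lemma isBigO_exp_shift {f : ℝ → ℝ} {α : ℝ} (hf : f =O[atTop] fun s ↦ Real.exp (-α * s))
    (a : ℝ) : (fun s ↦ f (s + a)) =O[atTop] fun s ↦ Real.exp (-α * s) := by
  have h1 := hf.comp_tendsto (tendsto_atTop_add_const_right atTop a tendsto_id)
  refine h1.trans ?_
  refine IsBigO.of_bound (Real.exp (-α * a)) (Eventually.of_forall fun s ↦ ?_)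
  simp only [Function.comp_apply, id, Real.norm_eq_abs, Real.abs_exp, ← Real.exp_add]
  apply le_of_eq
  ring_nf

/-- A monotone f' satisfies f(s) - f(s-1) ≤ f'(s) ≤ f(s+1) - f(s) by the mean value theorem, and
shifting s by 1 changes an exponential only by a constant factor. -/
lemma isBigO_deriv_of_monotoneOn {f f' : ℝ → ℝ} {α s₁ : ℝ}
    (hd : ∀ s, s₁ < s → HasDerivAt f (f' s) s) (hm : MonotoneOn f' (Ioi s₁))
    (hf : f =O[atTop] fun s ↦ Real.exp (-α * s)) : f' =O[atTop] fun s ↦ Real.exp (-α * s) := by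
  have hsum : (fun s ↦ |f (s + 1)| + |f s| + |f s| + |f (s + -1)|)
      =O[atTop] fun s ↦ Real.exp (-α * s) :=
    (((isBigO_exp_shift hf 1).abs_left.add hf.abs_left).add hf.abs_left).add
      (isBigO_exp_shift hf (-1)).abs_left
  refine IsBigO.trans (IsBigO.of_bound 1 ?_) hsum
  filter_upwards [eventually_gt_atTop (s₁ + 1)] with s hs
  have hc : ∀ a b, s₁ < a → ContinuousOn f (Icc a b) := fun a b ha u hu ↦
    (hd u (ha.trans_le hu.1)).continuousAt.continuousWithinAt
  obtain ⟨ξ, hξ, hξ'⟩ := exists_hasDerivAt_eq_slope f f' (a := s + -1) (b := s) (by linarith)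
    (hc _ _ (by linarith)) fun u hu ↦ hd u (by linarith [hu.1])
  obtain ⟨η, hη, hη'⟩ := exists_hasDerivAt_eq_slope f f' (a := s) (b := s + 1) (by linarith)
    (hc _ _ (by linarith)) fun u hu ↦ hd u (by linarith [hu.1])
  have h1 : f' ξ ≤ f' s := hm (mem_Ioi.mpr (by linarith [hξ.1])) (mem_Ioi.mpr (by linarith))
    hξ.2.le
  have h2 : f' s ≤ f' η := hm (mem_Ioi.mpr (by linarith)) (mem_Ioi.mpr (by linarith [hη.1]))
    hη.1.le
  rw [hξ', show s - (s + -1) = 1 by ring, div_one] at h1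
  rw [hη', show s + 1 - s = 1 by ring, div_one] at h2
  have h3 := abs_nonneg (f (s + 1))
  have h4 := abs_nonneg (f (s + -1))
  have h5 := abs_nonneg (f s)
  rw [one_mul]
  refine le_trans (abs_le.mpr ?_) (le_abs_self _)
  constructor
  · linarith [neg_abs_le (f s), le_abs_self (f (s + -1))]
  · linarith [neg_abs_le (f s), le_abs_self (f (s + 1))]

/-- If the second derivative has constant sign, exponential decay passes to the first one. -/
lemma isBigO_deriv_of_sign {f f' f'' : ℝ → ℝ} {α s₁ : ℝ}
    (hd : ∀ s, s₁ < s → HasDerivAt f (f' s) s) (hd' : ∀ s, s₁ < s → HasDerivAt f' (f'' s) s)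
    (hsign : (∀ s, s₁ < s → 0 ≤ f'' s) ∨ ∀ s, s₁ < s → f'' s ≤ 0)
    (hf : f =O[atTop] fun s ↦ Real.exp (-α * s)) : f' =O[atTop] fun s ↦ Real.exp (-α * s) := by
  have hc : ContinuousOn f' (Ioi s₁) := fun u hu ↦ (hd' u hu).continuousAt.continuousWithinAt
  rcases hsign with h | h
  · refine isBigO_deriv_of_monotoneOn hd ?_ hf
    refine monotoneOn_of_hasDerivWithinAt_nonneg (convex_Ioi s₁) hc
      (f' := f'') (fun s hs ↦ ?_) (fun s hs ↦ ?_) <;> rw [interior_Ioi] at hs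
    · exact (hd' s hs).hasDerivWithinAt
    · exact h s hs
  · have : (fun s ↦ -f' s) =O[atTop] fun s ↦ Real.exp (-α * s) := by
      refine isBigO_deriv_of_monotoneOn (f := fun s ↦ -f s) (fun s hs ↦ (hd s hs).fun_neg) ?_
        hf.neg_left
      refine monotoneOn_of_hasDerivWithinAt_nonneg (convex_Ioi s₁) hc.neg
        (f' := fun s ↦ -f'' s) (fun s hs ↦ ?_) (fun s hs ↦ ?_) <;> rw [interior_Ioi] at hs
      · exact (hd' s hs).fun_neg.hasDerivWithinAt
      · linarith [h s hs]
    simpa using this.neg_left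

end FlatReparametrization

/-! ### Asymptotics of an algebraic branch at an exceptional abscissa. -/

section CurveEnds

open Polynomial Filter Topology Set Asymptotics
open scoped Polynomial.Bivariate

/-- A branch `(ξ s, η s)` of the curve `g = 0` with simple fibre roots, parametrised so that
`ξ s` tends to `c` exponentially, i.e. `ξ' = -(ξ - c)`. -/
structure IsCurveEnd (g : ℝ[X][Y]) (c s₀ : ℝ) (ξ η : ℝ → ℝ) : Prop where
  eq_zero : ∀ s, s₀ < s → g.evalEval (ξ s) (η s) = 0
  ne_zero : ∀ s, s₀ < s → (derivative g).evalEval (ξ s) (η s) ≠ 0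
  fst_ne : ∀ s, s₀ < s → ξ s ≠ c
  tendsto_fst : Tendsto ξ atTop (𝓝 c)
  hasDerivAt_fst : ∀ s, s₀ < s → HasDerivAt ξ (-(ξ s - c)) s
  hasDerivAt_snd : ∀ s, s₀ < s → HasDerivAt η
    ((-(xDeriv g).evalEval (ξ s) (η s) / (derivative g).evalEval (ξ s) (η s)) * (-(ξ s - c))) s

namespace IsCurveEnd

variable {g : ℝ[X][Y]} {c s₀ : ℝ} {ξ η : ℝ → ℝ}

lemma continuousAt_evalEval (h : IsCurveEnd g c s₀ ξ η) (H : ℝ[X][Y]) {s : ℝ} (hs : s₀ < s) :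
    ContinuousAt (fun s ↦ H.evalEval (ξ s) (η s)) s :=
  (hasDerivAt_evalEval H (h.hasDerivAt_fst s hs) (h.hasDerivAt_snd s hs)).continuousAt

/-- A polynomial has eventually constant sign along a curve end. -/
lemma exists_sign (h : IsCurveEnd g c s₀ ξ η) (hg : g.Monic) (H : ℝ[X][Y]) :
    ∃ s₁, s₀ ≤ s₁ ∧ ((∀ s, s₁ < s → 0 ≤ H.evalEval (ξ s) (η s)) ∨
      ∀ s, s₁ < s → H.evalEval (ξ s) (η s) ≤ 0) := by
  obtain ⟨q, hq, hqH⟩ := exists_integral_relation g hg H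
  -- After removal of the power of the variable dividing q, the constant term of q₁ is a nonzero
  -- polynomial in x, hence nonzero at ξ s for all large s.
  obtain ⟨q₁, hq₁, hdvd⟩ := exists_eq_pow_rootMultiplicity_mul_and_not_dvd q hq.ne_zero 0
  set k := q.rootMultiplicity 0
  rw [C_0, sub_zero] at hq₁ hdvd
  have hc0 : q₁.coeff 0 ≠ 0 := fun h0 ↦ hdvd (X_dvd_iff.mpr h0)
  have hev : ∀ᶠ s in atTop, (q₁.coeff 0).eval (ξ s) ≠ 0 := by
    have h1 : Tendsto ξ atTop (𝓝[≠] c) := tendsto_nhdsWithin_iff.mpr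
      ⟨h.tendsto_fst, (eventually_gt_atTop s₀).mono h.fst_ne⟩
    have h2 : ∀ᶠ x in cofinite, (q₁.coeff 0).eval x ≠ 0 := by
      refine ((q₁.coeff 0).roots.toFinset.finite_toSet.subset fun x hx ↦ ?_)
      simpa [hc0] using hx
    exact h1.eventually (h2.filter_mono (nhdsNE_le_cofinite c))
  obtain ⟨s₂, hs₂⟩ := eventually_atTop.mp hev
  refine ⟨max s₀ s₂, le_max_left _ _, ?_⟩
  set f : ℝ → ℝ := fun s ↦ H.evalEval (ξ s) (η s) with hf
  have hconst : ∀ s ∈ Ioi (max s₀ s₂), ∀ᶠ t in 𝓝 s, SignType.sign (f t) = SignType.sign (f s) := by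
    intro s hs
    have hs0 : s₀ < s := (le_max_left _ _).trans_lt hs
    have hfc : ContinuousAt f s := h.continuousAt_evalEval H hs0
    rcases lt_trichotomy (f s) 0 with hlt | heq | hgt
    · filter_upwards [hfc.eventually_lt continuousAt_const hlt] with t ht
      rw [sign_neg ht, sign_neg hlt]
    -- At a zero of f the cofactor q₁ stays nonzero nearby, so the relation forces f = 0 there. Thus
    -- zeros of f are interior, and the sign is locally constant.
    · have hq1s : q₁.evalEval (ξ s) (f s) ≠ 0 := by
        rw [heq, evalEval, C_0, ← coeff_zero_eq_eval_zero]
        exact hs₂ s ((le_max_right _ _).trans hs.le)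
      have hcont : ContinuousAt (fun t ↦ q₁.evalEval (ξ t) (f t)) s :=
        ContinuousAt.comp (f := fun t ↦ (ξ t, f t)) (continuous_evalEval q₁).continuousAt
          ((h.hasDerivAt_fst s hs0).continuousAt.prodMk hfc)
      filter_upwards [hcont.eventually_ne hq1s, Ioi_mem_nhds hs0] with t ht ht0
      have h3 := hqH _ _ (h.eq_zero t ht0)
      rw [hq₁, evalEval_mul, evalEval_pow, evalEval_X] at h3
      have h4 : f t = 0 := eq_zero_of_pow_eq_zero ((mul_eq_zero.mp h3).resolve_right ht)
      rw [h4, heq]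
    · filter_upwards [continuousAt_const.eventually_lt hfc hgt] with t ht
      rw [sign_pos ht, sign_pos hgt]
  have hcon : ContinuousOn (fun t ↦ SignType.sign (f t)) (Ioi (max s₀ s₂)) := fun s hs ↦
    (continuousAt_const.congr (EventuallyEq.symm (hconst s hs))).continuousWithinAt
  have hm : max s₀ s₂ + 1 ∈ Ioi (max s₀ s₂) := by simp
  have hall : ∀ s ∈ Ioi (max s₀ s₂), SignType.sign (f s) = SignType.sign (f (max s₀ s₂ + 1)) :=
    fun s hs ↦ isPreconnected_Ioi.constant hcon hs hm
  rcases le_total 0 (f (max s₀ s₂ + 1)) with h0 | h0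
  · left
    intro s hs
    rw [← sign_nonneg_iff, hall s hs, sign_nonneg_iff]
    exact h0
  · right
    intro s hs
    rw [← sign_nonpos_iff, hall s hs, sign_nonpos_iff]
    exact h0

/-- The numerator of the `k`-th derivative of `η - y₀` along a curve end, where the denominator
is the `2k`-th power of the fibre derivative of `g`. -/
noncomputable def derivNumerator (g : ℝ[X][Y]) (c y₀ : ℝ) : ℕ → ℝ[X][Y]
  | 0 => Polynomial.X - C (C y₀)
  | k + 1 => -C (Polynomial.X - C c) *
      ((xDeriv (derivNumerator g c y₀ k) * derivative g
          - derivative (derivNumerator g c y₀ k) * xDeriv g) * derivative g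
        - 2 * (k : ℝ[X][Y]) * derivNumerator g c y₀ k *
          (xDeriv (derivative g) * derivative g - derivative (derivative g) * xDeriv g))

/-- The `k`-th derivative of `η - y₀` along a curve end. -/
noncomputable def iterDeriv (g : ℝ[X][Y]) (c y₀ : ℝ) (ξ η : ℝ → ℝ) (k : ℕ) (s : ℝ) : ℝ :=
  (derivNumerator g c y₀ k).evalEval (ξ s) (η s) / ((derivative g).evalEval (ξ s) (η s)) ^ (2 * k)

lemma iterDeriv_zero (y₀ s : ℝ) : iterDeriv g c y₀ ξ η 0 s = η s - y₀ := by
  simp [iterDeriv, derivNumerator]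

/-- Each differentiation costs two factors of g_y in the denominator, one from the quotient rule and
one from the slope -g_x / g_y of the branch. -/
lemma hasDerivAt_iterDeriv (h : IsCurveEnd g c s₀ ξ η) (y₀ : ℝ) (k : ℕ) {s : ℝ} (hs : s₀ < s) :
    HasDerivAt (iterDeriv g c y₀ ξ η k) (iterDeriv g c y₀ ξ η (k + 1) s) s := by
  have h1 := hasDerivAt_evalEval (derivNumerator g c y₀ k) (h.hasDerivAt_fst s hs)
    (h.hasDerivAt_snd s hs)
  have h2 := hasDerivAt_evalEval (derivative g) (h.hasDerivAt_fst s hs) (h.hasDerivAt_snd s hs)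
  have hne := h.ne_zero s hs
  refine (h1.fun_div (h2.fun_pow (2 * k)) (pow_ne_zero _ hne)).congr_deriv ?_
  simp only [iterDeriv, derivNumerator, evalEval_mul, evalEval_sub, evalEval_neg, evalEval_C,
    eval_sub, eval_X, eval_C, evalEval_natCast]
  have h22 : (2 : ℝ[X][Y]).evalEval (ξ s) (η s) = 2 := by
    exact_mod_cast evalEval_natCast (ξ s) (η s) 2
  rw [h22]
  generalize (derivative g).evalEval (ξ s) (η s) = G at hne ⊢
  -- The case k = 0 is separate because of the truncated exponent 2 * k - 1.
  rcases k with _ | k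
  · simp
    field_simp
    ring
  · rw [show 2 * (k + 1) - 1 = 2 * k + 1 by omega]
    push_cast
    field_simp
    ring

/-- The denominator is an even power, so the sign is that of a polynomial along the branch. -/
lemma exists_sign_iterDeriv (h : IsCurveEnd g c s₀ ξ η) (hg : g.Monic) (y₀ : ℝ) (k : ℕ) :
    ∃ s₁, s₀ ≤ s₁ ∧ ((∀ s, s₁ < s → 0 ≤ iterDeriv g c y₀ ξ η k s) ∨
      ∀ s, s₁ < s → iterDeriv g c y₀ ξ η k s ≤ 0) := by
  obtain ⟨s₁, hs₁, h1⟩ := h.exists_sign hg (derivNumerator g c y₀ k)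
  have hpos : ∀ s, 0 ≤ ((derivative g).evalEval (ξ s) (η s)) ^ (2 * k) := fun s ↦ by
    rw [pow_mul]; positivity
  refine ⟨s₁, hs₁, h1.imp (fun h2 s hs ↦ div_nonneg (h2 s hs) (hpos s)) fun h2 s hs ↦
    div_nonpos_of_nonpos_of_nonneg (h2 s hs) (hpos s)⟩

/-- A curve end has a limit point. -/
lemma exists_tendsto_snd (h : IsCurveEnd g c s₀ ξ η) (hg : g.Monic) :
    ∃ y₀, Tendsto η atTop (𝓝 y₀) := by
  obtain ⟨s₁, hs₁, hsign⟩ := h.exists_sign_iterDeriv hg 0 1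
  obtain ⟨B, hB, hBr⟩ := exists_continuous_root_bound hg
  have hbd : ∀ᶠ s in atTop, |η s| ≤ B c + 1 := by
    have h1 : ∀ᶠ s in atTop, B (ξ s) < B c + 1 :=
      (hB.continuousAt.tendsto.comp h.tendsto_fst).eventually_lt_const (by linarith)
    filter_upwards [h1, eventually_gt_atTop s₀] with s hs hs0
    exact (hBr _ _ (h.eq_zero s hs0)).trans hs.le
  obtain ⟨s₂, hs₂⟩ := eventually_atTop.mp hbd
  have hd : ∀ s, s₁ < s → HasDerivAt η (iterDeriv g c 0 ξ η 1 s) s := by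
    intro s hs
    have h1 := h.hasDerivAt_iterDeriv 0 0 (hs₁.trans_lt hs)
    refine h1.congr_of_eventuallyEq (Eventually.of_forall fun t ↦ ?_)
    rw [iterDeriv_zero, sub_zero]
  have hc : ContinuousOn η (Ioi s₁) := fun s hs ↦ (hd s hs).continuousAt.continuousWithinAt
  set a := max (s₁ + 1) s₂ with ha
  have ha1 : ∀ s, max s a ∈ Ioi s₁ := fun s ↦ by
    have := le_max_left (s₁ + 1) s₂
    exact mem_Ioi.mpr (lt_of_lt_of_le (by linarith) (le_max_right s a))
  have hb : ∀ s, |η (max s a)| ≤ B c + 1 := fun s ↦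
    hs₂ _ ((le_max_right _ _).trans (le_max_right s a))
  have hev : (fun s ↦ η (max s a)) =ᶠ[atTop] η := by
    filter_upwards [eventually_ge_atTop a] with s hs
    rw [max_eq_left hs]
  rcases hsign with hs | hs
  · have hm : MonotoneOn η (Ioi s₁) := by
      refine monotoneOn_of_hasDerivWithinAt_nonneg (convex_Ioi s₁) hc
        (f' := iterDeriv g c 0 ξ η 1) (fun s hs' ↦ ?_) (fun s hs' ↦ ?_) <;>
        rw [interior_Ioi] at hs'
      · exact (hd s hs').hasDerivWithinAt
      · exact hs s hs'
    have hm' : Monotone fun s ↦ η (max s a) := fun s t hst ↦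
      hm (ha1 s) (ha1 t) (max_le_max hst le_rfl)
    refine ⟨_, (tendsto_atTop_ciSup hm' ⟨B c + 1, ?_⟩).congr' hev⟩
    rintro _ ⟨s, rfl⟩
    exact (abs_le.mp (hb s)).2
  · have hm : AntitoneOn η (Ioi s₁) := by
      refine antitoneOn_of_hasDerivWithinAt_nonpos (convex_Ioi s₁) hc
        (f' := iterDeriv g c 0 ξ η 1) (fun s hs' ↦ ?_) (fun s hs' ↦ ?_) <;>
        rw [interior_Ioi] at hs'
      · exact (hd s hs').hasDerivWithinAt
      · exact hs s hs'
    have hm' : Antitone fun s ↦ η (max s a) := fun s t hst ↦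
      hm (ha1 s) (ha1 t) (max_le_max hst le_rfl)
    refine ⟨_, (tendsto_atTop_ciInf hm' ⟨-(B c + 1), ?_⟩).congr' hev⟩
    rintro _ ⟨s, rfl⟩
    exact (abs_le.mp (hb s)).1

/-- The differential equation for ξ makes (ξ - c) exp s constant. -/
lemma isBigO_fst (h : IsCurveEnd g c s₀ ξ η) :
    (fun s ↦ ξ s - c) =O[atTop] fun s ↦ Real.exp (-s) := by
  have hd : ∀ s, s₀ < s → HasDerivAt (fun s ↦ (ξ s - c) * Real.exp s) 0 s := by
    intro s hs
    refine (((h.hasDerivAt_fst s hs).sub_const c).fun_mul (Real.hasDerivAt_exp s)).congr_deriv ?_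
    ring
  set K := (ξ (s₀ + 1) - c) * Real.exp (s₀ + 1)
  have hK : ∀ s, s₀ < s → (ξ s - c) * Real.exp s = K := by
    intro s hs
    refine IsOpen.is_const_of_deriv_eq_zero (f := fun s ↦ (ξ s - c) * Real.exp s) isOpen_Ioi
      isPreconnected_Ioi (s := Ioi s₀)
      (fun t ht ↦ (hd t ht).differentiableAt.differentiableWithinAt)
      (fun t ht ↦ (hd t ht).deriv) hs (by simp)
  refine IsBigO.of_bound |K| ?_
  filter_upwards [eventually_gt_atTop s₀] with s hs
  rw [← hK s hs, Real.norm_eq_abs, Real.norm_eq_abs, Real.abs_exp, abs_mul, Real.abs_exp, mul_assoc,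
    ← Real.exp_add, add_neg_cancel, Real.exp_zero, mul_one]

/-- The Puiseux-type estimate: a curve end approaches its limit exponentially. -/
lemma exists_isBigO_snd (h : IsCurveEnd g c s₀ ξ η) (hg : g.Monic) {y₀ : ℝ}
    (hy₀ : Tendsto η atTop (𝓝 y₀)) :
    ∃ α : ℝ, 0 < α ∧ α ≤ 1 ∧ (fun s ↦ η s - y₀) =O[atTop] fun s ↦ Real.exp (-α * s) := by
  have hXY : Tendsto (fun s ↦ (ξ s, η s)) atTop (𝓝 (c, y₀)) := h.tendsto_fst.prodMk_nhds hy₀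
  have hcY : Tendsto (fun s ↦ (c, η s)) atTop (𝓝 (c, y₀)) := tendsto_const_nhds.prodMk_nhds hy₀
  have hlim : g.evalEval c y₀ = 0 := by
    have h1 := ((continuous_evalEval g).tendsto (c, y₀)).comp hXY
    refine tendsto_nhds_unique h1 (tendsto_const_nhds.congr' ?_)
    filter_upwards [eventually_gt_atTop s₀] with s hs
    exact (h.eq_zero s hs).symm
  -- If y₀ is a root of g(c, ·) of multiplicity m, then |η - y₀|^m ≲ |g(c, η)| = |g(c, η) - g(ξ, η)|
  -- ≲ |ξ - c| ≲ exp(-s), which gives the exponent 1/m.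
  set G := g.map (evalRingHom c) with hGdef
  have hG : G ≠ 0 := (hg.map _).ne_zero
  obtain ⟨q, hq, hdvd⟩ := exists_eq_pow_rootMultiplicity_mul_and_not_dvd G hG y₀
  set m := G.rootMultiplicity y₀ with hm
  have hm0 : m ≠ 0 := by
    refine ((rootMultiplicity_pos hG).mpr ?_).ne'
    rw [IsRoot, hGdef, map_evalRingHom_eval, hlim]
  have hq0 : q.eval y₀ ≠ 0 := fun h0 ↦ hdvd (dvd_iff_isRoot.mpr h0)
  obtain ⟨K, t, ht, hK⟩ := ((contDiff_evalEval g).contDiffAt (x := (c, y₀))).of_le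
    (show (1 : WithTop ℕ∞) ≤ ∞ by simp) |>.exists_lipschitzOnWith
  have h1 : (fun s ↦ G.eval (η s)) =O[atTop] fun s ↦ ξ s - c := by
    refine IsBigO.of_bound K ?_
    filter_upwards [hXY.eventually ht, hcY.eventually ht, eventually_gt_atTop s₀] with s h1 h2 h3
    have h4 := hK.dist_le_mul _ h2 _ h1
    rw [Prod.dist_eq, dist_self, max_eq_left dist_nonneg] at h4
    simp only [h.eq_zero s h3] at h4
    rw [hGdef, map_evalRingHom_eval]
    simpa [Real.dist_eq, abs_sub_comm] using h4
  have h2 : (fun s ↦ (η s - y₀) ^ m) =O[atTop] fun s ↦ G.eval (η s) := by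
    have h3 : (fun s ↦ (q.eval (η s))⁻¹) =O[atTop] fun _ ↦ (1 : ℝ) :=
      ((q.continuous.continuousAt.tendsto.comp hy₀).inv₀ hq0).isBigO_one ℝ
    have h4 := (isBigO_refl (fun s ↦ G.eval (η s)) atTop).mul h3
    refine (h4.congr' ?_ (by simp))
    filter_upwards [(q.continuous.continuousAt.tendsto.comp hy₀).eventually_ne hq0] with s hs
    have : q.eval (η s) ≠ 0 := hs
    rw [hq, eval_mul, eval_pow, eval_sub, eval_X, eval_C, mul_assoc, mul_inv_cancel₀ this, mul_one]
  have hmpos : (0 : ℝ) < m := by exact_mod_cast Nat.pos_of_ne_zero hm0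
  refine ⟨(m : ℝ)⁻¹, by positivity, inv_le_one_of_one_le₀ (by
    exact_mod_cast Nat.one_le_iff_ne_zero.mpr hm0), IsBigO.of_pow hm0 ?_⟩
  refine ((h2.trans h1).trans h.isBigO_fst).congr (fun s ↦ rfl) fun s ↦ ?_
  rw [Pi.pow_apply, ← Real.exp_nat_mul]
  congr 1
  field_simp

/-- All derivatives along a curve end decay exponentially. -/
lemma exists_isBigO_iterDeriv (h : IsCurveEnd g c s₀ ξ η) (hg : g.Monic) {y₀ : ℝ}
    (hy₀ : Tendsto η atTop (𝓝 y₀)) :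
    ∃ α : ℝ, 0 < α ∧ α ≤ 1 ∧
      ∀ k, iterDeriv g c y₀ ξ η k =O[atTop] fun s ↦ Real.exp (-α * s) := by
  obtain ⟨α, hα, hα1, hO⟩ := h.exists_isBigO_snd hg hy₀
  refine ⟨α, hα, hα1, fun k ↦ ?_⟩
  induction k with
  | zero => exact hO.congr_left fun s ↦ (iterDeriv_zero y₀ s).symm
  | succ k ih =>
    -- The constant sign of derivative k + 2 makes derivative k + 1 monotone, so it inherits the
    -- decay of derivative k with the same α.
    obtain ⟨s₁, hs₁, hsign⟩ := h.exists_sign_iterDeriv hg y₀ (k + 2)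
    exact isBigO_deriv_of_sign (fun s hs ↦ h.hasDerivAt_iterDeriv y₀ k (hs₁.trans_lt hs))
      (fun s hs ↦ h.hasDerivAt_iterDeriv y₀ (k + 1) (hs₁.trans_lt hs)) hsign ih

end IsCurveEnd

end CurveEnds

/-! ### Separating sets and their intersection with graphs. -/

section PlaneSeparation

open Polynomial Filter Topology Set
open scoped Polynomial.Bivariate

/-- The ball is homeomorphic to the whole space with centre corresponding to 0, and the complement
of a point is connected in dimension greater than one. -/
lemma isPreconnected_ball_diff_center {E : Type*} [NormedAddCommGroup E] [NormedSpace ℝ E]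
    (hE : 1 < Module.rank ℝ E) (z : E) {r : ℝ} (hr : 0 < r) :
    IsPreconnected (Metric.ball z r \ {z}) := by
  have h1 : IsPreconnected ({0}ᶜ : Set E) :=
    (isConnected_compl_singleton_of_one_lt_rank hE 0).isPreconnected
  set e := OpenPartialHomeomorph.univBall z r with he
  have h0 : e 0 = z := OpenPartialHomeomorph.univBall_apply_zero z r
  have h2 : Metric.ball z r \ {z} = e '' {0}ᶜ := by
    have ht : e.target = Metric.ball z r := OpenPartialHomeomorph.univBall_target z hr
    have hs : e.source = univ := OpenPartialHomeomorph.univBall_source z r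
    ext w
    constructor
    · rintro ⟨hw, hwz⟩
      rw [← ht] at hw
      refine ⟨e.symm w, fun h ↦ hwz ?_, e.right_inv hw⟩
      rw [mem_singleton_iff, ← e.right_inv hw, mem_singleton_iff.mp h, h0]
    · rintro ⟨v, hv, rfl⟩
      refine ⟨ht ▸ e.map_source (hs ▸ mem_univ v), fun h ↦ hv ?_⟩
      rw [mem_singleton_iff, ← h0] at h
      exact e.injOn (hs ▸ mem_univ v) (hs ▸ mem_univ 0) h
  rw [h2]
  exact h1.image _ (OpenPartialHomeomorph.continuous_univBall z r).continuousOn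

/-- The set `S` separates the disjoint open sets `U` and `V`, and each of its points is
approached from both sides. -/
structure IsSeparating {E : Type*} [TopologicalSpace E] (S U V : Set E) : Prop where
  isOpen_left : IsOpen U
  isOpen_right : IsOpen V
  disjoint : Disjoint U V
  eq_compl : S = (U ∪ V)ᶜ
  subset_left : S ⊆ closure U
  subset_right : S ⊆ closure V

namespace IsSeparating

section General

variable {E : Type*} [TopologicalSpace E] {S U V : Set E}

lemma symm (h : IsSeparating S U V) : IsSeparating S V U :=
  ⟨h.isOpen_right, h.isOpen_left, h.disjoint.symm, by rw [h.eq_compl, union_comm], h.subset_right,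
    h.subset_left⟩

lemma isClosed (h : IsSeparating S U V) : IsClosed S := by
  rw [h.eq_compl]
  exact (h.isOpen_left.union h.isOpen_right).isClosed_compl

lemma subset_or_subset (h : IsSeparating S U V) {T : Set E} (hT : IsPreconnected T)
    (hTS : Disjoint T S) : T ⊆ U ∨ T ⊆ V := by
  refine hT.subset_or_subset h.isOpen_left h.isOpen_right h.disjoint ?_
  rw [h.eq_compl, disjoint_compl_right_iff_subset] at hTS
  exact hTS

end General

variable {E : Type*} [NormedAddCommGroup E] [NormedSpace ℝ E] {S U V : Set E}

/-- Around an isolated point a punctured ball would be connected and disjoint from S, hence on one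
side, although the other side also accumulates at z. -/
lemma mem_closure_diff_singleton (hE : 1 < Module.rank ℝ E) (h : IsSeparating S U V) {z : E}
    (hz : z ∈ S) : z ∈ closure (S \ {z}) := by
  by_contra hcl
  obtain ⟨r, hr, hball⟩ := Metric.isOpen_iff.mp isClosed_closure.isOpen_compl z hcl
  have key : ∀ {A B : Set E}, IsSeparating S A B → Metric.ball z r \ {z} ⊆ A → False := by
    intro A B hAB hA
    obtain ⟨w, hw, hwB⟩ := mem_closure_iff.mp (hAB.subset_right hz) _ Metric.isOpen_ball
      (Metric.mem_ball_self hr)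
    by_cases hwz : w = z
    · rw [hAB.eq_compl] at hz
      exact hz (Or.inr (hwz ▸ hwB))
    · exact hAB.disjoint.le_bot ⟨hA ⟨hw, hwz⟩, hwB⟩
  have hdis : Disjoint (Metric.ball z r \ {z}) S := by
    rw [Set.disjoint_left]
    rintro w ⟨hw, hwz⟩ hwS
    exact hball hw (subset_closure ⟨hwS, hwz⟩)
  rcases h.subset_or_subset (isPreconnected_ball_diff_center hE z hr) hdis with h1 | h1
  · exact key h h1
  · exact key h.symm h1

/-- A separating set has no isolated points, so removing finitely many points keeps it dense in
itself. -/
lemma subset_closure_diff_finite (hE : 1 < Module.rank ℝ E) (h : IsSeparating S U V) {F : Set E}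
    (hF : F.Finite) : S ⊆ closure (S \ F) := by
  intro z hz
  have h1 := h.mem_closure_diff_singleton hE hz
  have hopen : IsOpen (F \ {z})ᶜ := (hF.subset sdiff_subset).isClosed.isOpen_compl
  rw [mem_closure_iff] at h1 ⊢
  intro O hO hzO
  obtain ⟨w, ⟨hwO, hwF⟩, hwS, hwz⟩ := h1 (O ∩ (F \ {z})ᶜ) (hO.inter hopen) ⟨hzO, by simp⟩
  exact ⟨w, hwO, hwS, fun hw ↦ hwF ⟨hw, hwz⟩⟩

end IsSeparating

/-- The set `Z` coincides locally at `(x, φ x)` with part of the graph of `φ`. -/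
def IsLocallyGraph (Z : Set (ℝ × ℝ)) (φ : ℝ → ℝ) (x : ℝ) : Prop :=
  ∀ᶠ v : ℝ × ℝ in 𝓝 (x, φ x), v ∈ Z → v.2 = φ v.1

/-- The uniqueness part of the implicit function theorem, transferred from the local solution to φ.
-/
lemma isLocallyGraph_of_branch {g : ℝ[X][Y]} {φ : ℝ → ℝ} {x : ℝ}
    (hφ : ∀ᶠ x' in 𝓝 x, g.evalEval x' (φ x') = 0) (hφc : ContinuousAt φ x)
    (hne : (derivative g).evalEval x (φ x) ≠ 0) :
    IsLocallyGraph {v | g.evalEval v.1 v.2 = 0} φ x := by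
  obtain ⟨ψ, -, -, hψ, -⟩ := exists_local_root g hφ.self_of_nhds hne
  have h1 : ∀ᶠ x' in 𝓝 x, φ x' = ψ x' := by
    have h2 : Tendsto (fun x' ↦ (x', φ x')) (𝓝 x) (𝓝 (x, φ x)) :=
      tendsto_id.prodMk_nhds hφc
    filter_upwards [h2.eventually hψ, hφ] with x' h3 h4 using h3 h4
  have h5 : ∀ᶠ v : ℝ × ℝ in 𝓝 (x, φ x), φ v.1 = ψ v.1 :=
    (continuous_fst.tendsto (x, φ x)).eventually h1
  filter_upwards [hψ, h5] with v h6 h7 h8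
  rw [h7, h6 h8]

/-- A separating set contained locally in a graph contains the graph near each of its points. -/
lemma IsSeparating.eventually_mem {S U V : Set (ℝ × ℝ)} (h : IsSeparating S U V) {φ : ℝ → ℝ}
    {x : ℝ} (hφ : ∀ᶠ x' in 𝓝 x, ContinuousAt φ x') (hloc : IsLocallyGraph S φ x)
    (hx : (x, φ x) ∈ S) : ∀ᶠ x' in 𝓝 x, (x', φ x') ∈ S := by
  -- The shear Θ straightens the graph to the horizontal axis.
  set Θ : ℝ × ℝ → ℝ × ℝ := fun w ↦ (w.1, φ w.1 + w.2) with hΘ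
  have hφx : ContinuousAt φ x := hφ.self_of_nhds
  have hΘc : ∀ w : ℝ × ℝ, ContinuousAt φ w.1 → ContinuousAt Θ w := fun w hw ↦
    continuousAt_fst.prodMk ((hw.comp continuousAt_fst).add continuousAt_snd)
  have h1 : ∀ᶠ w : ℝ × ℝ in 𝓝 (x, 0), ContinuousAt φ w.1 ∧ (Θ w ∈ S → w.2 = 0) := by
    have h2 : Tendsto Θ (𝓝 (x, 0)) (𝓝 (x, φ x)) := by
      have := (hΘc (x, 0) hφx).tendsto
      simpa [hΘ] using this
    filter_upwards [h2.eventually hloc, (continuous_fst.tendsto (x, (0 : ℝ))).eventually hφ]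
      with w h3 h4
    refine ⟨h4, fun h5 ↦ ?_⟩
    have := h3 h5
    simpa [hΘ] using this
  obtain ⟨r, hr, hball⟩ := Metric.eventually_nhds_iff_ball.mp h1
  have hmem : ∀ w : ℝ × ℝ, |w.1 - x| < r → |w.2| < r → w ∈ Metric.ball ((x, 0) : ℝ × ℝ) r := by
    intro w hw1 hw2
    rw [Metric.mem_ball, Prod.dist_eq, max_lt_iff, Real.dist_eq, Real.dist_eq]
    exact ⟨hw1, by simpa using hw2⟩
  set I := Ioo (x - r) (x + r) with hI
  have hIx : ∀ x' ∈ I, |x' - x| < r := fun x' hx' ↦ by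
    rw [abs_lt]; exact ⟨by linarith [hx'.1], by linarith [hx'.2]⟩
  set Tp := Θ '' (I ×ˢ Ioo 0 r) with hTp
  set Tm := Θ '' (I ×ˢ Ioo (-r) 0) with hTm
  -- A strip strictly above or below the graph is connected and misses S, so it lies in U or in V.
  have hpre : ∀ a b : ℝ, -r ≤ a → b ≤ r → (0 : ℝ) ∉ Ioo a b →
      Θ '' (I ×ˢ Ioo a b) ⊆ U ∨ Θ '' (I ×ˢ Ioo a b) ⊆ V := by
    intro a b ha hb h0
    have hin : ∀ w ∈ I ×ˢ Ioo a b, w ∈ Metric.ball ((x, 0) : ℝ × ℝ) r := fun w hw ↦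
      hmem w (hIx _ hw.1) (abs_lt.mpr ⟨by linarith [hw.2.1], by linarith [hw.2.2]⟩)
    refine h.subset_or_subset ?_ ?_
    · refine (isPreconnected_Ioo.prod isPreconnected_Ioo).image _ fun w hw ↦ ?_
      exact (hΘc w (hball w (hin w hw)).1).continuousWithinAt
    · rw [Set.disjoint_left]
      rintro _ ⟨w, hw, rfl⟩ hS
      have := (hball w (hin w hw)).2 hS
      exact h0 (this ▸ hw.2)
  have hboth : ∀ O : Set (ℝ × ℝ), IsOpen O → ∀ x' ∈ I, (x', φ x') ∈ O →
      (Tp ∩ O).Nonempty ∧ (Tm ∩ O).Nonempty := by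
    intro O hO x' hx' hxO
    have hc : ContinuousAt (fun s : ℝ ↦ Θ (x', s)) 0 := by
      have : Continuous fun s : ℝ ↦ Θ (x', s) :=
        continuous_const.prodMk (continuous_const_add (φ x'))
      exact this.continuousAt
    have hev : ∀ᶠ s in 𝓝 (0 : ℝ), Θ (x', s) ∈ O :=
      hc.eventually (hO.mem_nhds (by simpa [hΘ] using hxO))
    constructor
    · have h2 : ∀ᶠ s in 𝓝[>] (0 : ℝ), Θ (x', s) ∈ O ∧ s ∈ Ioo 0 r :=
        (hev.filter_mono nhdsWithin_le_nhds).and (Ioo_mem_nhdsGT hr)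
      obtain ⟨s, hs, hs'⟩ := h2.exists
      exact ⟨_, ⟨(x', s), ⟨hx', hs'⟩, rfl⟩, hs⟩
    · have h2 : ∀ᶠ s in 𝓝[<] (0 : ℝ), Θ (x', s) ∈ O ∧ s ∈ Ioo (-r) 0 :=
        (hev.filter_mono nhdsWithin_le_nhds).and (Ioo_mem_nhdsLT (by linarith))
      obtain ⟨s, hs, hs'⟩ := h2.exists
      exact ⟨_, ⟨(x', s), ⟨hx', hs'⟩, rfl⟩, hs⟩
  have hIn : I ∈ 𝓝 x := Ioo_mem_nhds (by linarith) (by linarith)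
  -- Both strips cannot lie on one side: the other side accumulates at (x, φ x), and if it met the
  -- graph nearby it would, being open, meet the strips too.
  have hsame : ∀ {A B : Set (ℝ × ℝ)}, IsSeparating S A B → Tp ⊆ A → Tm ⊆ A → False := by
    intro A B hAB hpA hmA
    have hnb : {v : ℝ × ℝ | v.1 ∈ I ∧ |v.2 - φ v.1| < r} ∈ 𝓝 (x, φ x) := by
      have hc1 : ContinuousAt (fun v : ℝ × ℝ ↦ |v.2 - φ v.1|) (x, φ x) :=
        (continuousAt_snd.sub (ContinuousAt.comp (f := Prod.fst) hφx continuousAt_fst)).abs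
      have h2 : ∀ᶠ v : ℝ × ℝ in 𝓝 (x, φ x), |v.2 - φ v.1| < r :=
        hc1.eventually_lt continuousAt_const (by simpa using hr)
      exact ((continuous_fst.tendsto (x, φ x)).eventually hIn).and h2
    obtain ⟨v, ⟨hv1, hv2⟩, hvB⟩ := mem_closure_iff_nhds.mp (hAB.subset_right hx) _ hnb
    have hv : Θ (v.1, v.2 - φ v.1) = v := by simp [hΘ]
    rw [abs_lt] at hv2
    rcases lt_trichotomy (v.2 - φ v.1) 0 with hlt | heq | hgt
    · exact hAB.disjoint.le_bot ⟨hmA ⟨(v.1, v.2 - φ v.1), ⟨hv1, hv2.1, hlt⟩, hv⟩, hvB⟩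
    · have : v = (v.1, φ v.1) := Prod.ext rfl (by linarith)
      obtain ⟨u, huT, huB⟩ := (hboth B hAB.isOpen_right v.1 hv1 (this ▸ hvB)).1
      exact hAB.disjoint.le_bot ⟨hpA huT, huB⟩
    · exact hAB.disjoint.le_bot ⟨hpA ⟨(v.1, v.2 - φ v.1), ⟨hv1, hgt, hv2.2⟩, hv⟩, hvB⟩
  -- With strips on opposite sides, a graph point in the open set A or B would have points of that
  -- set in the wrong strip, so it lies in S.
  have hopp : ∀ {A B : Set (ℝ × ℝ)}, IsSeparating S A B → Tp ⊆ A → Tm ⊆ B →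
      ∀ x' ∈ I, (x', φ x') ∈ S := by
    intro A B hAB hpA hmB x' hx'
    rw [hAB.eq_compl]
    rintro (hA | hB)
    · obtain ⟨u, huT, hu⟩ := (hboth A hAB.isOpen_left x' hx' hA).2
      exact hAB.disjoint.le_bot ⟨hu, hmB huT⟩
    · obtain ⟨u, huT, hu⟩ := (hboth B hAB.isOpen_right x' hx' hB).1
      exact hAB.disjoint.le_bot ⟨hpA huT, hu⟩
  refine Filter.mem_of_superset hIn ?_
  rcases hpre 0 r (by linarith) le_rfl (by simp) with hp | hp <;>
    rcases hpre (-r) 0 le_rfl hr.le (by simp) with hm | hm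
  · exact (hsame h hp hm).elim
  · exact hopp h hp hm
  · exact hopp h.symm hp hm
  · exact (hsame h.symm hp hm).elim

/-- A separating set contains a connected graph branch entirely or misses it entirely. -/
lemma IsSeparating.forall_mem_or_forall_notMem {S U V : Set (ℝ × ℝ)} (h : IsSeparating S U V)
    {φ : ℝ → ℝ} {J : Set ℝ} (hJ : IsPreconnected J) (hJo : IsOpen J)
    (hφ : ∀ x ∈ J, ContinuousAt φ x) (hloc : ∀ x ∈ J, IsLocallyGraph S φ x) :
    (∀ x ∈ J, (x, φ x) ∈ S) ∨ ∀ x ∈ J, (x, φ x) ∉ S := by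
  classical
  set f : ℝ → Bool := fun x ↦ decide ((x, φ x) ∈ S) with hf
  -- Membership in S is locally constant along the graph: it persists by
  -- `IsSeparating.eventually_mem`, and non-membership persists because S is closed.
  have hcont : ContinuousOn f J := by
    intro x hx
    refine (continuousAt_const (y := f x).congr ?_).continuousWithinAt
    by_cases hxS : (x, φ x) ∈ S
    · filter_upwards [h.eventually_mem (Filter.mem_of_superset (hJo.mem_nhds hx) hφ) (hloc x hx)
        hxS] with x' hx'
      simp [hf, hxS, hx']
    · have hc : ContinuousAt (fun x ↦ (x, φ x)) x := continuousAt_id.prodMk (hφ x hx)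
      filter_upwards [hc.eventually (h.isClosed.isOpen_compl.mem_nhds hxS)] with x' hx'
      have : (x', φ x') ∉ S := hx'
      simp [hf, hxS, this]
  by_contra! hcon
  obtain ⟨⟨a, haJ, ha⟩, b, hbJ, hb⟩ := hcon
  have := hJ.constant hcont haJ hbJ
  simp [hf, ha, hb] at this

/-- The tangent cone of a set that is locally a differentiable graph. -/
lemma tangentConeAt_of_locally_graph {S : Set (ℝ × ℝ)} {φ : ℝ → ℝ} {x φ' : ℝ}
    (hφ : HasDerivAt φ φ' x) (hloc : IsLocallyGraph S φ x)
    (hmem : ∀ᶠ x' in 𝓝 x, (x', φ x') ∈ S) :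
    tangentConeAt ℝ S (x, φ x) = {v | ∃ c : ℝ, v = c • ((1, φ') : ℝ × ℝ)} := by
  apply Subset.antisymm
  · intro v hv
    -- This function vanishes on S near the point, so its derivative annihilates every tangent
    -- direction.
    have h1 : HasFDerivAt (fun w : ℝ × ℝ ↦ w.2 - φ w.1)
        (ContinuousLinearMap.snd ℝ ℝ ℝ - φ' • ContinuousLinearMap.fst ℝ ℝ ℝ) (x, φ x) :=
      hasFDerivAt_snd.sub (hφ.comp_hasFDerivAt (f := Prod.fst) (x, φ x) hasFDerivAt_fst)
    rw [← tangentConeAt_inter_nhds hloc] at hv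
    have h2 := h1.hasFDerivWithinAt.mapsTo_tangent_cone hv
    have h3 : (fun w : ℝ × ℝ ↦ w.2 - φ w.1) '' (S ∩ {w | w ∈ S → w.2 = φ w.1}) ⊆ {0} := by
      rintro _ ⟨w, ⟨hw1, hw2⟩, rfl⟩
      simp [hw2 hw1]
    have h4 := tangentConeAt_subset_zero (𝕜 := ℝ) (s := ({0} : Set ℝ)) (x := φ x - φ x)
      (by
        intro hacc
        have := accPt_iff_frequently.mp hacc
        obtain ⟨y, hy1, hy2⟩ := this.exists
        simp only [sub_self] at hy1
        exact hy1 hy2)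
      (tangentConeAt_mono h3 h2)
    refine ⟨v.1, ?_⟩
    have h5 : v.2 - φ' * v.1 = 0 := by simpa using h4
    ext
    · simp
    · simp only [Prod.smul_snd, smul_eq_mul]
      linarith
  · rintro _ ⟨c, rfl⟩
    have h1 : HasDerivAt (fun t : ℝ ↦ (t, φ t)) (1, φ') x := (hasDerivAt_id x).prodMk hφ
    -- Conversely, the graph parametrisation maps the tangent cone of a neighbourhood of x, which is
    -- all of ℝ, into that of S.
    have hc : c ∈ tangentConeAt ℝ {x' | (x', φ x') ∈ S} x := by
      rw [tangentConeAt_of_mem_nhds hmem]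
      exact mem_univ c
    have h2 := (h1.hasFDerivAt.hasFDerivWithinAt (s := {x' | (x', φ x') ∈ S})).mapsTo_tangent_cone
      hc
    have h3 : (fun t : ℝ ↦ (t, φ t)) '' {x' | (x', φ x') ∈ S} ⊆ S := by
      rintro _ ⟨t, ht, rfl⟩
      exact ht
    simpa using tangentConeAt_mono h3 h2

end PlaneSeparation

/-! ### Smooth arcs from branches, compact and unbounded. -/

section Arcs

open Polynomial Filter Topology Set Asymptotics
open scoped Polynomial.Bivariate

/-- `φ` is at `x` a root of `g(x, ·)`, simple and depending differentiably on `x`. -/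
structure IsBranchAt (g : ℝ[X][Y]) (φ : ℝ → ℝ) (x : ℝ) : Prop where
  eq_zero : g.evalEval x (φ x) = 0
  ne_zero : (derivative g).evalEval x (φ x) ≠ 0
  hasDerivAt : HasDerivAt φ
    (-(xDeriv g).evalEval x (φ x) / (derivative g).evalEval x (φ x)) x

/-- Bootstrapping: φ' is a rational function of x and φ with nonvanishing denominator, so it is as
smooth as φ. -/
lemma contDiffOn_of_isBranchAt {g : ℝ[X][Y]} {φ : ℝ → ℝ} {J : Set ℝ} (hJ : IsOpen J)
    (hφ : ∀ x ∈ J, IsBranchAt g φ x) : ContDiffOn ℝ ∞ φ J := by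
  rw [contDiffOn_infty]
  intro n
  induction n with
  | zero =>
    rw [Nat.cast_zero, contDiffOn_zero]
    exact fun x hx ↦ (hφ x hx).hasDerivAt.continuousAt.continuousWithinAt
  | succ n ih =>
    rw [Nat.cast_succ, contDiffOn_succ_iff_deriv_of_isOpen hJ]
    refine ⟨fun x hx ↦ (hφ x hx).hasDerivAt.differentiableAt.differentiableWithinAt, by simp, ?_⟩
    have h1 : ∀ H : ℝ[X][Y], ContDiffOn ℝ n (fun x ↦ H.evalEval x (φ x)) J := fun H ↦
      (((contDiff_evalEval H).of_le (by exact_mod_cast le_top)).comp_contDiffOn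
        (contDiffOn_id.prodMk ih))
    refine ((h1 (xDeriv g)).neg.div (h1 (derivative g)) fun x hx ↦ (hφ x hx).ne_zero).congr
      fun x hx ↦ ?_
    exact (hφ x hx).hasDerivAt.deriv

/-- With τ = exp(-s), the range 0 < τ < 2 becomes s > -log 2, and x = c + ρτ approaches c as s → ∞.
-/
lemma isCurveEnd_of_isBranchAt {g : ℝ[X][Y]} {φ : ℝ → ℝ} {c ρ : ℝ} (hρ : ρ ≠ 0)
    (hφ : ∀ τ ∈ Ioo (0 : ℝ) 2, IsBranchAt g φ (c + ρ * τ)) :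
    IsCurveEnd g c (-Real.log 2) (fun s ↦ c + ρ * Real.exp (-s))
      (fun s ↦ φ (c + ρ * Real.exp (-s))) := by
  have hτ : ∀ s : ℝ, -Real.log 2 < s → Real.exp (-s) ∈ Ioo (0 : ℝ) 2 := fun s hs ↦
    ⟨Real.exp_pos _, by
      rw [← Real.lt_log_iff_exp_lt (by norm_num)]; linarith⟩
  have hd : ∀ s : ℝ, HasDerivAt (fun s ↦ c + ρ * Real.exp (-s))
      (-((c + ρ * Real.exp (-s)) - c)) s := fun s ↦
    ((((hasDerivAt_neg s).exp).const_mul ρ).const_add c).congr_deriv (by ring)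
  refine ⟨fun s hs ↦ (hφ _ (hτ s hs)).eq_zero, fun s hs ↦ (hφ _ (hτ s hs)).ne_zero,
    fun s _ h ↦ ?_, ?_, fun s _ ↦ hd s, fun s hs ↦ ?_⟩
  · have : ρ * Real.exp (-s) = 0 := by linarith
    exact (mul_ne_zero hρ (Real.exp_pos _).ne') this
  · have := (Real.tendsto_exp_neg_atTop_nhds_zero.const_mul ρ).const_add c
    simpa using this
  · exact (hφ _ (hτ s hs)).hasDerivAt.comp s (hd s)

/-- The flat parametrisation is smooth for t < (1 - log 2)⁻¹. This leaves room beyond t = 1, giving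
smoothness at that endpoint. -/
lemma one_lt_inv_one_sub_log_two : (1 : ℝ) < (1 + -Real.log 2)⁻¹ := by
  have h1 := Real.log_two_lt_d9
  have h2 := Real.log_two_gt_d9
  rw [one_lt_inv₀ (by linarith)]
  linarith

/-- A branch of an algebraic curve over a half-open interval ending at `c` is a compact smooth
arc, after adding its limit point. -/
lemma exists_compact_arc (L : (ℝ × ℝ) ≃L[ℝ] ℂ) {g : ℝ[X][Y]} (hg : g.Monic) {φ : ℝ → ℝ} {c ρ : ℝ}
    (hρ : ρ ≠ 0) (hφ : ∀ τ ∈ Ioo (0 : ℝ) 2, IsBranchAt g φ (c + ρ * τ)) :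
    ∃ (γ : SmoothPlaneArc) (y₀ : ℝ), γ.dom = Icc 0 1 ∧ γ.toFun 0 = L (c, y₀) ∧
      ∀ t ∈ Ioc (0 : ℝ) 1, γ.toFun t =
        L (c + ρ * Real.exp (1 - t⁻¹), φ (c + ρ * Real.exp (1 - t⁻¹))) := by
  have hend := isCurveEnd_of_isBranchAt hρ hφ
  set s₀ := -Real.log 2 with hs₀
  have hs₀1 : -1 < s₀ := by have := Real.log_two_lt_d9; linarith
  have hT : (1 : ℝ) < (1 + s₀)⁻¹ := one_lt_inv_one_sub_log_two
  obtain ⟨y₀, hy₀⟩ := hend.exists_tendsto_snd hg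
  obtain ⟨α, hα, -, hO⟩ := hend.exists_isBigO_iterDeriv hg hy₀
  set W := IsCurveEnd.iterDeriv g c y₀ (fun s ↦ c + ρ * Real.exp (-s))
    (fun s ↦ φ (c + ρ * Real.exp (-s)))
  -- The successive derivatives of ξ - c = ρ exp(-s), to be flattened like those of η - y₀.
  set Wx : ℕ → ℝ → ℝ := fun k s ↦ (-1) ^ k * ρ * Real.exp (-s) with hWx
  have hWxd : ∀ k, ∀ s, s₀ < s → HasDerivAt (Wx k) (Wx (k + 1) s) s := fun k s _ ↦
    (((hasDerivAt_neg s).exp).const_mul _).congr_deriv (by simp only [hWx]; ring)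
  have hWxO : ∀ k, Wx k =O[atTop] fun s ↦ Real.exp (-1 * s) := fun k ↦ by
    simpa using (isBigO_refl (fun s : ℝ ↦ Real.exp (-s)) atTop).const_mul_left ((-1) ^ k * ρ)
  have hy := contDiffOn_flatExtension hα hs₀1 (fun k s hs ↦ hend.hasDerivAt_iterDeriv y₀ k hs) hO
    1 0
  have hx := contDiffOn_flatExtension one_pos hs₀1 hWxd hWxO 1 0
  set f : ℝ → ℂ := fun t ↦ L (c + flatExtension 1 (Wx 0) t, y₀ + flatExtension 1 (W 0) t) with hf
  have hfc : ContDiffOn ℝ ∞ f (Iio (1 + s₀)⁻¹) :=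
    L.contDiff.comp_contDiffOn ((contDiffOn_const.add hx).prodMk (contDiffOn_const.add hy))
  refine ⟨⟨f, Icc 0 1, Or.inl rfl, hfc.mono fun t ht ↦ ht.2.trans_lt hT, ?_⟩, y₀, rfl, ?_, ?_⟩
  · intro t ht hzero
    rw [interior_Icc] at ht
    have htT : t < (1 + s₀)⁻¹ := ht.2.trans hT
    -- Regularity is read off the first coordinate c + ρ exp(1 - 1/t), whose derivative vanishes at
    -- no t > 0.
    have h1 : HasDerivAt (fun t ↦ (L.symm (f t)).1) (L.symm (deriv f t)).1 t := by
      have h2 : HasDerivAt f (deriv f t) t :=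
        ((hfc.contDiffAt (Iio_mem_nhds htT)).differentiableAt (by simp)).hasDerivAt
      have h3 := L.symm.hasFDerivAt.comp_hasDerivAt t h2
      exact (hasFDerivAt_fst.comp_hasDerivAt t h3)
    have h4 := (hasDerivAt_flatExtension 1 one_pos hs₀1 (hWxd 0) (hWxO 0) htT).const_add c
    have h5 := h1.unique (h4.congr_of_eventuallyEq (Eventually.of_forall fun t ↦ by simp [hf]))
    rw [hzero, flatExtension_of_pos _ _ ht.1, flatExtension_of_pos _ _ ht.1] at h5
    have : t = 0 ∨ ρ = 0 := by simpa [hWx] using h5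
    exact this.elim ht.1.ne' hρ
  · simp [hf, flatExtension_of_nonpos]
  · intro t ht
    simp only [hf]
    rw [flatExtension_of_pos _ _ ht.1, flatExtension_of_pos _ _ ht.1]
    simp [hWx, W, IsCurveEnd.iterDeriv_zero]

/-- A smooth graph over a closed half-line is a smooth arc going to infinity. -/
lemma exists_unbounded_arc (L : (ℝ × ℝ) ≃L[ℝ] ℂ) {φ : ℝ → ℝ} {J : Set ℝ} (hJ : IsOpen J)
    (hφ : ContDiffOn ℝ ∞ φ J) {m σ : ℝ} (hσ : σ ≠ 0) (hmJ : ∀ t, 0 ≤ t → m + σ * t ∈ J) :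
    ∃ γ : SmoothPlaneArc, γ.dom = Ici 0 ∧
      ∀ t, γ.toFun t = L (m + σ * t, φ (m + σ * t)) := by
  set f : ℝ → ℂ := fun t ↦ L (m + σ * t, φ (m + σ * t)) with hf
  have haff : ContDiff ℝ ∞ fun t : ℝ ↦ m + σ * t := by fun_prop
  set O := (fun t : ℝ ↦ m + σ * t) ⁻¹' J
  have hO : IsOpen O := hJ.preimage haff.continuous
  have hfc : ContDiffOn ℝ ∞ f O :=
    L.contDiff.comp_contDiffOn (haff.contDiffOn.prodMk (hφ.comp haff.contDiffOn fun t ht ↦ ht))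
  refine ⟨⟨f, Ici 0, Or.inr ⟨rfl, ?_⟩, hfc.mono hmJ, ?_⟩, rfl, fun t ↦ rfl⟩
  · refine L.antilipschitz.tendsto_cobounded.comp ?_
    rw [← tendsto_norm_atTop_iff_cobounded]
    have h1 : Tendsto (fun t : ℝ ↦ |σ| * t - |m|) atTop atTop :=
      tendsto_atTop_add_const_right _ _ (tendsto_id.const_mul_atTop (abs_pos.mpr hσ))
    refine tendsto_atTop_mono' _ ?_ h1
    filter_upwards [eventually_ge_atTop 0] with t ht
    refine le_trans ?_ (norm_fst_le _)
    have h2 := abs_sub_abs_le_abs_sub (σ * t) (-m)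
    rw [abs_mul, abs_neg, abs_of_nonneg ht] at h2
    rw [Real.norm_eq_abs, add_comm m]
    simpa using h2
  · intro t ht hzero
    rw [interior_Ici] at ht
    have h1 : HasDerivAt (fun t ↦ (L.symm (f t)).1) (L.symm (deriv f t)).1 t := by
      have h2 : HasDerivAt f (deriv f t) t :=
        ((hfc.contDiffAt (hO.mem_nhds (hmJ t (le_of_lt ht)))).differentiableAt
          (by simp)).hasDerivAt
      have h3 := L.symm.hasFDerivAt.comp_hasDerivAt t h2
      exact (hasFDerivAt_fst.comp_hasDerivAt t h3)
    have h4 : HasDerivAt (fun t : ℝ ↦ m + σ * t) (σ * 1) t :=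
      ((hasDerivAt_id t).const_mul σ).const_add m
    have h5 := h1.unique (h4.congr_of_eventuallyEq (Eventually.of_forall fun t ↦ by simp [hf]))
    rw [hzero] at h5
    simp at h5
    exact hσ h5.symm

end Arcs

/-! ### Cutting the branches at midpoints of the gaps between exceptional abscissas. -/

section Decomposition

open Polynomial Filter Topology Set
open scoped Polynomial.Bivariate

/-- The arc `γ` runs over the part of the graph of `φ` above `R`, apart from a possible endpoint
above `c`. -/
structure IsArcOver (L : (ℝ × ℝ) ≃L[ℝ] ℂ) (γ : SmoothPlaneArc) (φ : ℝ → ℝ) (R : Set ℝ) (c : ℝ) :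
    Prop where
  mem : ∀ t ∈ γ.dom, (L.symm (γ.toFun t)).1 ≠ c →
    (L.symm (γ.toFun t)).1 ∈ R ∧ (L.symm (γ.toFun t)).2 = φ (L.symm (γ.toFun t)).1
  surj : ∀ x ∈ R, L (x, φ x) ∈ γ.toFun '' γ.dom
  inj : ∀ t ∈ γ.dom, ∀ t' ∈ γ.dom, (L.symm (γ.toFun t)).1 = (L.symm (γ.toFun t')).1 →
    (L.symm (γ.toFun t)).1 ≠ c → t = t'
  isClosed : IsClosed (γ.toFun '' γ.dom)
  subset : ∀ T : Set ℂ, IsClosed T → (∀ x ∈ R, L (x, φ x) ∈ T) → γ.toFun '' γ.dom ⊆ T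

/-- The arc covers only distance δ from c, while the branch is assumed up to 2δ; the surplus matches
the range 0 < τ < 2 of `exists_compact_arc` with ρ = σδ. -/
lemma exists_isArcOver_near (L : (ℝ × ℝ) ≃L[ℝ] ℂ) {g : ℝ[X][Y]} (hg : g.Monic) {φ : ℝ → ℝ}
    {c σ δ : ℝ} (hσ : σ * σ = 1) (hδ : 0 < δ)
    (hφ : ∀ x, 0 < σ * (x - c) → σ * (x - c) < 2 * δ → IsBranchAt g φ x) :
    ∃ γ, IsArcOver L γ φ {x | 0 < σ * (x - c) ∧ σ * (x - c) ≤ δ} c := by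
  have hσ0 : σ ≠ 0 := by rintro rfl; simp at hσ
  have hρ : σ * δ ≠ 0 := mul_ne_zero hσ0 hδ.ne'
  have hkey : ∀ τ, σ * (c + σ * δ * τ - c) = δ * τ := fun τ ↦ by linear_combination δ * τ * hσ
  obtain ⟨γ, y₀, hdom, h0, hγ⟩ := exists_compact_arc L hg (φ := φ) (c := c) hρ (fun τ hτ ↦ by
    refine hφ _ ?_ ?_ <;> rw [hkey]
    · exact mul_pos hδ hτ.1
    · rw [mul_comm 2]; exact mul_lt_mul_of_pos_left hτ.2 hδ)
  have hR : ∀ t ∈ Ioc (0 : ℝ) 1, c + σ * δ * Real.exp (1 - t⁻¹) ∈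
      {x | 0 < σ * (x - c) ∧ σ * (x - c) ≤ δ} := by
    intro t ht
    rw [mem_ofPred_eq, hkey]
    refine ⟨by positivity, mul_le_of_le_one_right hδ.le ?_⟩
    rw [Real.exp_le_one_iff, sub_nonpos]
    exact (one_le_inv₀ ht.1).mpr ht.2
  have hcont : ContinuousOn γ.toFun γ.dom := γ.contDiffOn.continuousOn
  have hpos : ∀ t ∈ γ.dom, (L.symm (γ.toFun t)).1 ≠ c → t ∈ Ioc (0 : ℝ) 1 := by
    intro t ht hne
    rw [hdom] at ht
    refine ⟨lt_of_le_of_ne ht.1 fun h ↦ hne ?_, ht.2⟩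
    rw [← h, h0, L.symm_apply_apply]
  have hfst : ∀ t ∈ Ioc (0 : ℝ) 1,
      (L.symm (γ.toFun t)).1 = c + σ * δ * Real.exp (1 - t⁻¹) := fun t ht ↦ by
    rw [hγ t ht, L.symm_apply_apply]
  refine ⟨γ, ⟨fun t ht hne ↦ ?_, fun x hx ↦ ?_, fun t ht t' ht' heq hne ↦ ?_, ?_,
    fun T hT hTR ↦ ?_⟩⟩
  · have htp := hpos t ht hne
    rw [hγ t htp, L.symm_apply_apply]
    exact ⟨hR t htp, rfl⟩
  · set τ := σ * (x - c) / δ with hτ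
    have hτ0 : 0 < τ := div_pos hx.1 hδ
    have hτ1 : τ ≤ 1 := (div_le_one hδ).mpr hx.2
    have hlog : Real.log τ ≤ 0 := Real.log_nonpos hτ0.le hτ1
    -- The parameter solves exp(1 - 1/t) = τ.
    have ht : (1 - Real.log τ)⁻¹ ∈ Ioc (0 : ℝ) 1 :=
      ⟨inv_pos.mpr (by linarith), inv_le_one_of_one_le₀ (by linarith)⟩
    refine ⟨(1 - Real.log τ)⁻¹, hdom ▸ ⟨ht.1.le, ht.2⟩, ?_⟩
    have hxe : c + σ * δ * Real.exp (1 - ((1 - Real.log τ)⁻¹)⁻¹) = x := by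
      rw [inv_inv, sub_sub_cancel, Real.exp_log hτ0, hτ]
      field_simp
      linear_combination (x - c) * hσ
    rw [hγ _ ht, hxe]
  · have htp := hpos t ht hne
    have htp' := hpos t' ht' (heq ▸ hne)
    rw [hfst t htp, hfst t' htp'] at heq
    have h1 := mul_left_cancel₀ hρ (add_left_cancel heq)
    have h2 := Real.exp_injective h1
    exact inv_injective (sub_right_injective h2)
  · rw [hdom] at hcont ⊢
    exact (isCompact_Icc.image_of_continuousOn hcont).isClosed
  -- The endpoint at t = 0 is a limit of points over the half gap, so a closed set containing those
  -- contains it.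
  · have hcl : γ.dom = closure (Ioc (0 : ℝ) 1) := by rw [closure_Ioc zero_ne_one, hdom]
    have hmaps : MapsTo γ.toFun (Ioc (0 : ℝ) 1) T := fun t ht ↦ by
      rw [hγ t ht]
      exact hTR _ (hR t ht)
    rw [hcl] at hcont ⊢
    exact (hcont.image_closure.trans (closure_minimal hmaps.image_subset hT))

lemma exists_isArcOver_far (L : (ℝ × ℝ) ≃L[ℝ] ℂ) {g : ℝ[X][Y]} {φ : ℝ → ℝ}
    {c σ δ : ℝ} (hσ : σ * σ = 1) (hδ : 0 < δ)
    (hφ : ∀ x, 0 < σ * (x - c) → IsBranchAt g φ x) :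
    ∃ γ, IsArcOver L γ φ {x | δ ≤ σ * (x - c)} c := by
  have hσ0 : σ ≠ 0 := by rintro rfl; simp at hσ
  have hJ : IsOpen {x | 0 < σ * (x - c)} := isOpen_lt continuous_const (by fun_prop)
  have hkey : ∀ t, σ * (c + σ * δ + σ * t - c) = δ + t := fun t ↦ by
    linear_combination (δ + t) * hσ
  have hφc := contDiffOn_of_isBranchAt hJ hφ
  obtain ⟨γ, hdom, hγ⟩ := exists_unbounded_arc L hJ hφc (m := c + σ * δ) hσ0
    (fun t ht ↦ by rw [mem_ofPred_eq, hkey]; linarith)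
  -- As the graph of a continuous function over a closed half-line, the image is closed.
  have himage : γ.toFun '' γ.dom =
      L '' ({v : ℝ × ℝ | δ ≤ σ * (v.1 - c)} ∩ (fun v ↦ v.2 - φ v.1) ⁻¹' {0}) := by
    ext z
    constructor
    · rintro ⟨t, ht, rfl⟩
      rw [hdom] at ht
      refine ⟨_, ⟨?_, ?_⟩, (hγ t).symm⟩
      · rw [mem_ofPred_eq, hkey]
        linarith [mem_Ici.mp ht]
      · simp
    · rintro ⟨v, ⟨hv1, hv2⟩, rfl⟩
      have hv3 : v.2 = φ v.1 := sub_eq_zero.mp hv2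
      have hv4 : c + σ * δ + σ * (σ * (v.1 - c) - δ) = v.1 := by
        linear_combination (v.1 - c) * hσ
      refine ⟨σ * (v.1 - c) - δ, hdom ▸ mem_Ici.mpr (sub_nonneg.mpr hv1), ?_⟩
      rw [hγ, hv4, ← hv3]
  refine ⟨γ, ⟨fun t ht hne ↦ ?_, fun x hx ↦ ?_, fun t ht t' ht' heq hne ↦ ?_, ?_,
    fun T hT hTR ↦ ?_⟩⟩
  · rw [hdom] at ht
    rw [hγ, L.symm_apply_apply]
    refine ⟨?_, rfl⟩
    rw [mem_ofPred_eq, hkey]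
    linarith [mem_Ici.mp ht]
  · rw [himage]
    exact ⟨_, ⟨hx, by simp⟩, rfl⟩
  · rw [hγ, hγ, L.symm_apply_apply, L.symm_apply_apply] at heq
    exact mul_left_cancel₀ hσ0 (add_left_cancel heq)
  · rw [himage]
    refine L.toHomeomorph.isClosed_image.mpr ?_
    refine ContinuousOn.preimage_isClosed_of_isClosed ?_
      (isClosed_le continuous_const (by fun_prop)) isClosed_singleton
    refine continuousOn_snd.sub (hφc.continuousOn.comp continuousOn_fst fun v hv ↦ ?_)
    exact hδ.trans_le hv
  · rw [himage]
    rintro _ ⟨v, ⟨hv1, hv2⟩, rfl⟩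
    have hv3 : v = (v.1, φ v.1) := Prod.ext rfl (sub_eq_zero.mp hv2)
    rw [hv3]
    exact hTR _ hv1

/-- The points on the side `σ` of `c` before the next point of `E`. -/
def gapSet (E : Finset ℝ) (c σ : ℝ) : Set ℝ :=
  {x | 0 < σ * (x - c) ∧ ∀ e ∈ E, 0 < σ * (e - c) → σ * (x - c) < σ * (e - c)}

lemma isOpen_gapSet (E : Finset ℝ) (c σ : ℝ) : IsOpen (gapSet E c σ) := by
  have h1 : gapSet E c σ = {x | 0 < σ * (x - c)} ∩
      ⋂ e ∈ E, {x | 0 < σ * (e - c) → σ * (x - c) < σ * (e - c)} := by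
    ext x; simp [gapSet]
  rw [h1]
  refine (isOpen_lt continuous_const (by fun_prop)).inter (isOpen_biInter_finset fun e _ ↦ ?_)
  by_cases he : 0 < σ * (e - c)
  · simp only [he, true_imp_iff]
    exact isOpen_lt (by fun_prop) continuous_const
  · simp [he]

lemma isPreconnected_gapSet (E : Finset ℝ) (c σ : ℝ) : IsPreconnected (gapSet E c σ) := by
  refine Convex.isPreconnected fun x hx y hy a b ha hb hab ↦ ?_
  have hcomb : σ * (a • x + b • y - c) = a * (σ * (x - c)) + b * (σ * (y - c)) := by
    simp only [smul_eq_mul]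
    linear_combination (σ * c) * hab
  refine ⟨?_, fun e he hpos ↦ ?_⟩ <;> rw [hcomb]
  · rcases ha.eq_or_lt with rfl | ha'
    · rw [show b = 1 by linarith]; linarith [hy.1]
    · linarith [mul_pos ha' hx.1, mul_nonneg hb hy.1.le]
  · have h1 := hx.2 e he hpos
    have h2 := hy.2 e he hpos
    have h3 : σ * (e - c) = a * (σ * (e - c)) + b * (σ * (e - c)) := by
      rw [← add_mul, hab, one_mul]
    rw [h3]
    rcases ha.eq_or_lt with rfl | ha'
    · rw [show b = 1 by linarith]; linarith
    · linarith [mul_lt_mul_of_pos_left h1 ha', mul_le_mul_of_nonneg_left h2.le hb]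

lemma notMem_of_mem_gapSet {E : Finset ℝ} {c σ x : ℝ} (hx : x ∈ gapSet E c σ) : x ∉ E :=
  fun hxE ↦ lt_irrefl _ (hx.2 x hxE hx.1)

/-- The number δ is half the distance to the next point of E on the side σ; if there is none, the
value 1 is arbitrary. -/
lemma exists_gap (E : Finset ℝ) (c σ : ℝ) :
    ∃ δ : ℝ, 0 < δ ∧ (∀ e ∈ E, 0 < σ * (e - c) → 2 * δ ≤ σ * (e - c)) ∧
      ((∃ e ∈ E, 2 * δ = σ * (e - c)) ∨ ∀ e ∈ E, σ * (e - c) ≤ 0) := by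
  by_cases h : (E.filter fun e ↦ 0 < σ * (e - c)).Nonempty
  · obtain ⟨e, he, hmin⟩ := Finset.exists_min_image _ (fun e ↦ σ * (e - c)) h
    rw [Finset.mem_filter] at he
    refine ⟨σ * (e - c) / 2, by linarith [he.2], fun e' he' hpos ↦ ?_, Or.inl ⟨e, he.1, by ring⟩⟩
    have := hmin e' (Finset.mem_filter.mpr ⟨he', hpos⟩)
    linarith
  · have h1 : ∀ e ∈ E, σ * (e - c) ≤ 0 := fun e he ↦ by
      by_contra! hpos
      exact h ⟨e, Finset.mem_filter.mpr ⟨he, hpos⟩⟩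
    exact ⟨1, one_pos, fun e he hpos ↦ absurd (h1 e he) (not_le.mpr hpos), Or.inr h1⟩

/-- The sign encoded by a Boolean. -/
def boolSign (b : Bool) : ℝ := if b then 1 else -1

lemma boolSign_mul_self (b : Bool) : boolSign b * boolSign b = 1 := by
  cases b <;> simp [boolSign]

lemma abs_boolSign (b : Bool) : |boolSign b| = 1 := by
  cases b <;> simp [boolSign]

lemma boolSign_mul_eq_abs {b : Bool} {x : ℝ} (h : 0 < boolSign b * x) :
    boolSign b * x = |x| := by
  rw [← abs_of_pos h, abs_mul, abs_boolSign, one_mul]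

lemma boolSign_unique {b b' : Bool} {x : ℝ} (h : 0 < boolSign b * x) (h' : 0 < boolSign b' * x) :
    b = b' := by
  cases b <;> cases b' <;> simp [boolSign] at h h' ⊢ <;> linarith

lemma exists_boolSign {x : ℝ} (hx : x ≠ 0) : ∃ b, 0 < boolSign b * x := by
  rcases lt_or_gt_of_ne hx with h | h
  · exact ⟨false, by simpa [boolSign] using h⟩
  · exact ⟨true, by simpa [boolSign] using h⟩

/-- Every point off `E` lies in the near half of a gap or beyond all of `E`. -/
lemma exists_mem_half_gap {E : Finset ℝ} (hE : E.Nonempty) {δ : ℝ → Bool → ℝ}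
    (hδ0 : ∀ c b, 0 < δ c b)
    (hδ : ∀ c b, (∃ e ∈ E, 2 * δ c b = boolSign b * (e - c)) ∨ ∀ e ∈ E, boolSign b * (e - c) ≤ 0)
    {x : ℝ} (hx : x ∉ E) :
    ∃ c ∈ E, ∃ b, 0 < boolSign b * (x - c) ∧
      (boolSign b * (x - c) ≤ δ c b ∨ ∀ e ∈ E, boolSign b * (e - c) ≤ 0) := by
  -- With c a nearest point of E, x cannot be past the midpoint of its gap.
  obtain ⟨c, hc, hmin⟩ := E.exists_min_image (fun e ↦ |x - e|) hE
  have hne : x - c ≠ 0 := fun h ↦ hx (by rwa [sub_eq_zero.mp h])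
  obtain ⟨b, hb⟩ := exists_boolSign hne
  refine ⟨c, hc, b, hb, (hδ c b).imp_left ?_⟩
  rintro ⟨e, he, h2⟩
  by_contra! hlt
  have h3 := hmin e he
  have h4 : |x - e| = |boolSign b * (x - c) - 2 * δ c b| := by
    rw [h2, ← mul_sub, abs_mul, abs_boolSign, one_mul]
    congr 1
    ring
  rw [h4, ← boolSign_mul_eq_abs hb] at h3
  rcases abs_cases (boolSign b * (x - c) - 2 * δ c b) with h5 | h5 <;> rw [h5.1] at h3
  · linarith [hδ0 c b]
  · linarith

/-- Inside a half gap, `c` is the unique nearest point of `E`. -/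
lemma abs_sub_lt_of_half_gap {E : Finset ℝ} {δ c x : ℝ} {b : Bool}
    (hδ : ∀ e ∈ E, 0 < boolSign b * (e - c) → 2 * δ ≤ boolSign b * (e - c))
    (hx : 0 < boolSign b * (x - c))
    (hx' : boolSign b * (x - c) < δ ∨ ∀ e ∈ E, boolSign b * (e - c) ≤ 0) {e : ℝ} (he : e ∈ E)
    (hec : e ≠ c) : |x - c| < |x - e| := by
  have h1 : |x - e| = |boolSign b * (x - c) - boolSign b * (e - c)| := by
    rw [← mul_sub, abs_mul, abs_boolSign, one_mul]
    congr 1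
    ring
  rw [h1, ← boolSign_mul_eq_abs hx]
  have h2 : boolSign b * (e - c) ≠ 0 := by
    refine mul_ne_zero (fun h ↦ ?_) (sub_ne_zero.mpr hec)
    have := abs_boolSign b
    rw [h, abs_zero] at this
    exact zero_ne_one this
  rcases lt_or_gt_of_ne h2 with h3 | h3
  · exact lt_of_lt_of_le (by linarith) (le_abs_self _)
  · have h4 := hδ e he h3
    rcases hx' with h5 | h5
    · exact lt_of_lt_of_le (by linarith) (neg_le_abs _)
    · exact absurd (h5 e he) (not_le.mpr h3)

end Decomposition

/-! ### Separating subsets of an algebraic curve are piecewise smooth. -/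

section PlaneCurves

open Polynomial Filter Topology Set
open scoped Polynomial.Bivariate

lemma hasTangentLineAt_image (L : (ℝ × ℝ) ≃L[ℝ] ℂ) {S : Set (ℝ × ℝ)} {v u : ℝ × ℝ} (hu : u ≠ 0)
    (h : tangentConeAt ℝ S v = {w | ∃ c : ℝ, w = c • u}) : HasTangentLineAt (L '' S) (L v) := by
  refine ⟨L u, fun h0 ↦ hu (L.map_eq_zero_iff.mp h0), ?_⟩
  have h1 : MapsTo L (tangentConeAt ℝ S v) (tangentConeAt ℝ (L '' S) (L v)) :=
    L.hasFDerivAt.hasFDerivWithinAt.mapsTo_tangent_cone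
  have h2 : MapsTo L.symm (tangentConeAt ℝ (L '' S) (L v)) (tangentConeAt ℝ S v) := by
    have := (L.symm.hasFDerivAt.hasFDerivWithinAt (s := L '' S) (x := L v)).mapsTo_tangent_cone
    simpa [image_image] using this
  ext w
  constructor
  · intro hw
    have h3 := h2 hw
    rw [h] at h3
    obtain ⟨c, hc⟩ := h3
    refine ⟨c, ?_⟩
    rw [← map_smul, ← hc, L.apply_symm_apply]
  · rintro ⟨c, rfl⟩
    rw [← map_smul]
    exact h1 (h ▸ ⟨c, rfl⟩)

/-- A finite family of arcs can be reindexed by `Fin h`. -/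
lemma exists_presentation_of_fintype {κ : Type*} [Finite κ] {S : Set ℂ} (γ : κ → SmoothPlaneArc)
    (hS : S = ⋃ k, (γ k).toFun '' (γ k).dom) {F : Set ℂ} (hF : F.Finite)
    (hinj : ∀ k l, ∀ s ∈ (γ k).dom, ∀ t ∈ (γ l).dom, (γ k).toFun s = (γ l).toFun t →
      (γ k).toFun s ∉ F → k = l ∧ s = t) :
    ∃ (h : ℕ) (γ : Fin h → SmoothPlaneArc),
      IsPiecewiseSmoothPresentation S γ ∧ (selfIntersections γ).Finite := by
  obtain ⟨h, ⟨e⟩⟩ := Finite.exists_equiv_fin κ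
  refine ⟨h, fun i ↦ γ (e.symm i), ?_, hF.subset ?_⟩
  · rw [IsPiecewiseSmoothPresentation, hS]
    exact (e.symm.surjective.iUnion_comp fun k ↦ (γ k).toFun '' (γ k).dom).symm
  · rintro z ⟨k, l, s, hs, t, ht, hne, rfl, heq⟩
    by_contra hz
    obtain ⟨h1, h2⟩ := hinj _ _ s hs t ht heq.symm hz
    exact hne (Prod.ext (e.symm.injective h1) h2)

lemma one_lt_rank_real_prod : 1 < Module.rank ℝ (ℝ × ℝ) := by
  rw [← Module.finrank_eq_rank]
  norm_num [Module.finrank_prod]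

/-- A separating set inside a plane algebraic curve is a piecewise smooth curve with finitely many
self-intersections and with a tangent at all but finitely many points. -/
theorem IsSeparating.piecewise_smooth {S U V : Set (ℝ × ℝ)} (h : IsSeparating S U V)
    (L : (ℝ × ℝ) ≃L[ℝ] ℂ) {g : ℝ[X][Y]} (hg : g.Monic)
    (hgS : ∀ v ∈ S, g.evalEval v.1 v.2 = 0) {p q : ℝ[X][Y]} {d : ℝ[X]} (hd : d ≠ 0)
    (hpq : g * p + derivative g * q = C d) :
    (∃ (h : ℕ) (γ : Fin h → SmoothPlaneArc),
      IsPiecewiseSmoothPresentation (L '' S) γ ∧ (selfIntersections γ).Finite) ∧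
    {z ∈ L '' S | ¬ HasTangentLineAt (L '' S) z}.Finite := by
  classical
  -- The point 0 is added only to make E nonempty, so that a nearest point always exists.
  set E : Finset ℝ := insert 0 d.roots.toFinset with hEdef
  have hE : E.Nonempty := ⟨0, Finset.mem_insert_self _ _⟩
  have hsimple : ∀ x ∉ E, ∀ y, g.evalEval x y = 0 → (derivative g).evalEval x y ≠ 0 := by
    intro x hx y hy h0
    have h1 := congrArg (evalEval x y) hpq
    rw [evalEval_add, evalEval_mul, evalEval_mul, hy, h0, zero_mul, zero_mul, add_zero,
      evalEval_C] at h1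
    apply hx
    rw [hEdef, Finset.mem_insert, Multiset.mem_toFinset, mem_roots hd]
    exact Or.inr h1.symm
  have hbr := fun (c : ℝ) (b : Bool) ↦ exists_branches hg (isPreconnected_gapSet E c (boolSign b))
    fun x hx ↦ hsimple x (notMem_of_mem_gapSet hx)
  choose k φ hφ0 hφsurj hφinj hφd using hbr
  have hB : ∀ c b i, ∀ x ∈ gapSet E c (boolSign b), IsBranchAt g (φ c b i) x := fun c b i x hx ↦
    ⟨hφ0 c b i x hx, hsimple x (notMem_of_mem_gapSet hx) _ (hφ0 c b i x hx), hφd c b i x hx⟩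
  have hloc : ∀ c b i, ∀ x ∈ gapSet E c (boolSign b), IsLocallyGraph S (φ c b i) x := by
    intro c b i x hx
    have h1 := isLocallyGraph_of_branch (φ := φ c b i) (Filter.mem_of_superset
      ((isOpen_gapSet E c (boolSign b)).mem_nhds hx) (hφ0 c b i))
      (hφd c b i x hx).continuousAt (hB c b i x hx).ne_zero
    filter_upwards [h1] with v hv hvS using hv (hgS v hvS)
  have hall : ∀ c b i, ∀ x ∈ gapSet E c (boolSign b), (x, φ c b i x) ∈ S →
      ∀ x' ∈ gapSet E c (boolSign b), (x', φ c b i x') ∈ S := by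
    intro c b i x hx hxS
    exact (h.forall_mem_or_forall_notMem (isPreconnected_gapSet E c (boolSign b))
      (isOpen_gapSet E c (boolSign b)) (fun x hx ↦ (hφd c b i x hx).continuousAt)
      (hloc c b i)).resolve_right fun h1 ↦ h1 x hx hxS
  choose δ hδ0 hδ hδ' using fun (c : ℝ) (b : Bool) ↦ exists_gap E c (boolSign b)
  have hnear : ∀ c b, ∀ x, 0 < boolSign b * (x - c) → boolSign b * (x - c) < 2 * δ c b →
      x ∈ gapSet E c (boolSign b) := fun c b x hx hx' ↦
    ⟨hx, fun e he hpos ↦ hx'.trans_le (hδ c b e he hpos)⟩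
  have hfar : ∀ c b, (∀ e ∈ E, boolSign b * (e - c) ≤ 0) → ∀ x, 0 < boolSign b * (x - c) →
      x ∈ gapSet E c (boolSign b) := fun c b hcb x hx ↦
    ⟨hx, fun e he hpos ↦ absurd (hcb e he) (not_le.mpr hpos)⟩
  have hfinite : ∀ A : Finset ℝ, {v ∈ S | v.1 ∈ A}.Finite := by
    intro A
    refine (A.finite_toSet.biUnion fun x _ ↦
      ((fiberRoots g x).finite_toSet.image fun y ↦ (x, y))).subset ?_
    rintro ⟨x, y⟩ ⟨hv, hx⟩
    exact mem_biUnion hx ⟨y, (mem_fiberRoots hg).mpr (hgS _ hv), rfl⟩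
  have hcover : ∀ v ∈ S, v.1 ∉ E → ∃ c ∈ E, ∃ b i, v.1 ∈ gapSet E c (boolSign b) ∧
      v = (v.1, φ c b i v.1) ∧ 0 < boolSign b * (v.1 - c) ∧
        (boolSign b * (v.1 - c) ≤ δ c b ∨ ∀ e ∈ E, boolSign b * (e - c) ≤ 0) := by
    intro v hv hvE
    obtain ⟨c, hc, b, hb, hcb⟩ := exists_mem_half_gap hE hδ0 hδ' hvE
    have hgap : v.1 ∈ gapSet E c (boolSign b) := by
      rcases hcb with h1 | h1
      · exact hnear c b v.1 hb (by linarith [hδ0 c b])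
      · exact hfar c b h1 v.1 hb
    obtain ⟨i, hi⟩ := hφsurj c b v.1 hgap v.2 (hgS v hv)
    exact ⟨c, hc, b, i, hgap, Prod.ext rfl hi, hb, hcb⟩
  refine ⟨?_, ?_⟩
  swap
  · refine ((hfinite E).image L).subset ?_
    rintro _ ⟨⟨v, hv, rfl⟩, htan⟩
    refine ⟨v, ⟨hv, ?_⟩, rfl⟩
    by_contra hvE
    obtain ⟨c, hc, b, i, hgap, hvi, -⟩ := hcover v hv hvE
    apply htan
    have hmem : ∀ᶠ x' in 𝓝 v.1, (x', φ c b i x') ∈ S :=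
      Filter.mem_of_superset ((isOpen_gapSet E c (boolSign b)).mem_nhds hgap)
        (hall c b i v.1 hgap (hvi ▸ hv))
    have htc := tangentConeAt_of_locally_graph (hφd c b i v.1 hgap) (hloc c b i v.1 hgap) hmem
    rw [← hvi] at htc
    exact hasTangentLineAt_image L (fun h0 ↦ one_ne_zero (congrArg Prod.fst h0)) htc
  -- the index type of the arcs: end point, side, near or far, branch
  let good : (Σ (c : E) (b : Bool), Bool × Fin (k c b)) → Prop := fun a ↦
    (∀ x ∈ gapSet E a.1 (boolSign a.2.1), (x, φ a.1 a.2.1 a.2.2.2 x) ∈ S) ∧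
      (a.2.2.1 = true → ∀ e ∈ E, boolSign a.2.1 * (e - a.1) ≤ 0)
  let R : ℝ → Bool → Bool → Set ℝ := fun c b far ↦
    if far then {x | δ c b ≤ boolSign b * (x - c)}
      else {x | 0 < boolSign b * (x - c) ∧ boolSign b * (x - c) ≤ δ c b}
  have harc : ∀ a : {a // good a}, ∃ γ, IsArcOver L γ (φ a.1.1 a.1.2.1 a.1.2.2.2)
      (R a.1.1 a.1.2.1 a.1.2.2.1) a.1.1 := by
    rintro ⟨⟨⟨c, hc⟩, b, far, i⟩, hgood, hgood'⟩
    cases far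
    · exact exists_isArcOver_near L hg (boolSign_mul_self b) (hδ0 c b) fun x hx hx' ↦
        hB c b i x (hnear c b x hx hx')
    · exact exists_isArcOver_far L (boolSign_mul_self b) (hδ0 c b) fun x hx ↦
        hB c b i x (hfar c b (hgood' rfl) x hx)
  choose γ hγ using harc
  have hRgap : ∀ a : {a // good a}, ∀ x ∈ R a.1.1 a.1.2.1 a.1.2.2.1,
      x ∈ gapSet E a.1.1 (boolSign a.1.2.1) := by
    rintro ⟨⟨⟨c, hc⟩, b, far, i⟩, hgood, hgood'⟩ x hx
    cases far
    · exact hnear c b x hx.1 (by linarith [hx.2, hδ0 c b])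
    · exact hfar c b (hgood' rfl) x ((hδ0 c b).trans_le hx)
  -- Arcs can meet only over E or over the cut points at distance δ from points of E.
  set M : Finset ℝ := E ∪ (E ×ˢ Finset.univ).image fun cb : ℝ × Bool ↦
    cb.1 + boolSign cb.2 * δ cb.1 cb.2 with hM
  have hsubS : ∀ a, (γ a).toFun '' (γ a).dom ⊆ L '' S := fun a ↦
    (hγ a).subset _ (L.toHomeomorph.isClosed_image.mpr h.isClosed)
      fun x hx ↦ mem_image_of_mem L (a.2.1 x (hRgap a x hx))
  have hne : ∀ c ∈ E, ∀ b, ∀ x ∉ M, x ≠ c ∧ boolSign b * (x - c) ≠ δ c b := by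
    intro c hc b x hx
    refine ⟨fun h1 ↦ hx (Finset.mem_union_left _ (h1 ▸ hc)), fun h1 ↦ hx ?_⟩
    refine Finset.mem_union_right _ (Finset.mem_image.mpr ⟨(c, b), by simp [hc], ?_⟩)
    simp only
    linear_combination (-boolSign b) * h1 + (x - c) * boolSign_mul_self b
  refine exists_presentation_of_fintype γ ?_ ((hfinite M).image L) ?_
  · apply Subset.antisymm
    · have hcl : IsClosed (⋃ a, (γ a).toFun '' (γ a).dom) :=
        isClosed_iUnion_of_finite fun a ↦ (hγ a).isClosed
      -- Points of S over E need no separate arcs: S has no isolated points, so they are limits of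
      -- points off E, and the finite union of arcs is closed.
      have hsub : S ⊆ closure (S \ {v ∈ S | v.1 ∈ E}) :=
        h.subset_closure_diff_finite one_lt_rank_real_prod (hfinite E)
      refine (image_mono hsub).trans ((image_closure_subset_closure_image L.continuous).trans
        (closure_minimal ?_ hcl))
      rintro _ ⟨v, ⟨hv, hvE'⟩, rfl⟩
      have hvE : v.1 ∉ E := fun h1 ↦ hvE' ⟨hv, h1⟩
      obtain ⟨c, hc, b, i, hgap, hvi, hb, hcb⟩ := hcover v hv hvE
      have hgoodS := hall c b i v.1 hgap (hvi ▸ hv)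
      rw [mem_iUnion, hvi]
      by_cases hle : boolSign b * (v.1 - c) ≤ δ c b
      · let a : {a // good a} := ⟨⟨⟨c, hc⟩, b, false, i⟩, hgoodS, fun h1 ↦ by simp at h1⟩
        exact ⟨a, (hγ a).surj v.1 ⟨hb, hle⟩⟩
      · let a : {a // good a} := ⟨⟨⟨c, hc⟩, b, true, i⟩, hgoodS, fun _ ↦ hcb.resolve_left hle⟩
        exact ⟨a, (hγ a).surj v.1 (le_of_not_ge hle)⟩
    · exact iUnion_subset hsubS
  · intro a a' s hs t ht heq hF
    set z := (γ a).toFun s with hz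
    have hzM : (L.symm z).1 ∉ M := by
      intro hM'
      obtain ⟨v, hv, hvz⟩ := hsubS a (mem_image_of_mem _ hs)
      refine hF ⟨v, ⟨hv, ?_⟩, hvz⟩
      rwa [hz, ← hvz, L.symm_apply_apply] at hM'
    have hzc := (hne a.1.1 a.1.1.2 a.1.2.1 _ hzM)
    have hzc' := (hne a'.1.1 a'.1.1.2 a'.1.2.1 _ hzM)
    obtain ⟨hR, hφz⟩ := (hγ a).mem s hs hzc.1
    obtain ⟨hR', hφz'⟩ := (hγ a').mem t ht (heq ▸ hzc'.1)
    have hgap := hRgap a _ hR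
    have hgap' := hRgap a' _ hR'
    rw [← hz] at hR hφz hgap
    rw [← heq] at hR' hφz' hgap'
    suffices haa : a = a' by
      subst haa
      exact ⟨rfl, (hγ a).inj s hs t ht (by rw [← hz, heq]) hzc.1⟩
    clear_value z
    clear heq hs ht hF hz
    generalize L.symm z = v at *
    obtain ⟨⟨⟨c, hc⟩, b, far, i⟩, hgood, hgood'⟩ := a
    obtain ⟨⟨⟨c', hc'⟩, b', far', i'⟩, hgoodA, hgoodA'⟩ := a'
    dsimp only at *
    have hside : ∀ (c : ℝ) (b far : Bool), v.1 ∈ R c b far → boolSign b * (v.1 - c) ≠ δ c b →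
        (far = true → ∀ e ∈ E, boolSign b * (e - c) ≤ 0) →
        boolSign b * (v.1 - c) < δ c b ∨ ∀ e ∈ E, boolSign b * (e - c) ≤ 0 := by
      intro c b far h1 h2 h3
      cases far
      · exact Or.inl (lt_of_le_of_ne h1.2 h2)
      · exact Or.inr (h3 rfl)
    -- Off M the data of the arc are recovered from the point: c is the strictly nearest point of E,
    -- then the side, the branch and the half of the gap are determined.
    have hcc : c = c' := by
      by_contra hcne
      have h1 := abs_sub_lt_of_half_gap (hδ c b) hgap.1 (hside c b far hR hzc.2 hgood') hc'
        (Ne.symm hcne)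
      have h2 := abs_sub_lt_of_half_gap (hδ c' b') hgap'.1 (hside c' b' far' hR' hzc'.2 hgoodA') hc
        hcne
      exact lt_asymm h1 h2
    subst hcc
    obtain rfl : b = b' := boolSign_unique hgap.1 hgap'.1
    obtain rfl : i = i' := hφinj c b v.1 hgap (hφz.symm.trans hφz')
    have hff : far = far' := by
      cases far <;> cases far'
      · rfl
      · exact absurd (le_antisymm hR.2 hR') hzc.2
      · exact absurd (le_antisymm hR'.2 hR) hzc.2
      · rfl
    subst hff
    rfl

end PlaneCurves

/-! ### Singular value description of the pseudospectrum. -/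

section Pseudospectrum

open Filter Topology Set Matrix

variable {m n : ℕ}

/-- The scalar polynomial with coefficients `w_0, …, w_m`. -/
def weightPoly (w : Fin (m + 1) → ℝ) (r : ℝ) : ℝ := ∑ j : Fin (m + 1), w j * r ^ (j : ℕ)

lemma continuous_weightPoly (w : Fin (m + 1) → ℝ) : Continuous (weightPoly w) :=
  continuous_finsetSum _ fun _ _ ↦ continuous_const.mul (continuous_pow _)

lemma weightPoly_pos {w : Fin (m + 1) → ℝ} (hw : ∀ j, 0 ≤ w j) (hw0 : 0 < w 0) {r : ℝ}
    (hr : 0 ≤ r) : 0 < weightPoly w r := by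
  refine Finset.sum_pos' (fun _ _ ↦ mul_nonneg (hw _) (pow_nonneg hr _)) ⟨0, Finset.mem_univ _, ?_⟩
  simpa using hw0

/-- The operator on Euclidean space given by the value of a matrix polynomial. -/
noncomputable def polyOperator (P : Fin (m + 1) → Matrix (Fin n) (Fin n) ℂ) (z : ℂ) :
    EuclideanSpace ℂ (Fin n) →L[ℂ] EuclideanSpace ℂ (Fin n) :=
  toEuclideanCLM (n := Fin n) (𝕜 := ℂ) (matrixPolyEval P z)

lemma polyOperator_eq_sum (P : Fin (m + 1) → Matrix (Fin n) (Fin n) ℂ) (z : ℂ) :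
    polyOperator P z =
      ∑ j : Fin (m + 1), z ^ (j : ℕ) • toEuclideanCLM (n := Fin n) (𝕜 := ℂ) (P j) := by
  simp [polyOperator, matrixPolyEval, map_sum, map_smul]

lemma differentiable_polyOperator (P : Fin (m + 1) → Matrix (Fin n) (Fin n) ℂ) :
    Differentiable ℂ (polyOperator P) := by
  have : polyOperator P = fun z ↦
      ∑ j : Fin (m + 1), z ^ (j : ℕ) • toEuclideanCLM (n := Fin n) (𝕜 := ℂ) (P j) :=
    funext (polyOperator_eq_sum P)
  rw [this]
  fun_prop

lemma exists_unit_vector_of_det_eq_zero {A : Matrix (Fin n) (Fin n) ℂ} (hA : A.det = 0) :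
    ∃ v : EuclideanSpace ℂ (Fin n), ‖v‖ = 1 ∧ toEuclideanCLM (n := Fin n) (𝕜 := ℂ) A v = 0 := by
  obtain ⟨x, hx, hAx⟩ := exists_mulVec_eq_zero_iff.mpr hA
  have hx0 : WithLp.toLp 2 x ≠ 0 := fun h ↦ hx (by simpa using h)
  refine ⟨(‖WithLp.toLp 2 x‖⁻¹ : ℂ) • WithLp.toLp 2 x, ?_, ?_⟩
  · rw [norm_smul, norm_inv, Complex.norm_real, norm_norm,
      inv_mul_cancel₀ (norm_ne_zero_iff.mpr hx0)]
  · rw [map_smul, toEuclideanCLM_toLp, hAx]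
    simp

lemma det_eq_zero_of_toEuclideanCLM_eq_zero {A : Matrix (Fin n) (Fin n) ℂ}
    {v : EuclideanSpace ℂ (Fin n)} (hv : v ≠ 0)
    (hA : toEuclideanCLM (n := Fin n) (𝕜 := ℂ) A v = 0) : A.det = 0 := by
  refine exists_mulVec_eq_zero_iff.mp ⟨v.ofLp, fun h ↦ hv (by ext i; exact congrFun h i), ?_⟩
  have := congrArg WithLp.ofLp hA
  simpa [ofLp_toEuclideanCLM] using this

/-- There is a unimodular number that rotates `z` to the positive real axis. -/
lemma exists_unimodular_mul_eq_norm (z : ℂ) : ∃ ζ : ℂ, ‖ζ‖ = 1 ∧ ζ * z = ‖z‖ := by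
  rcases eq_or_ne z 0 with rfl | hz
  · exact ⟨1, by simp⟩
  · have h1 : (‖z‖ : ℂ) ≠ 0 := by exact_mod_cast norm_ne_zero_iff.mpr hz
    refine ⟨‖z‖ / z, ?_, div_mul_cancel₀ _ hz⟩
    rw [norm_div, Complex.norm_real, norm_norm, div_self (norm_ne_zero_iff.mpr hz)]

/-- The pseudospectrum in terms of the smallest singular value. -/
lemma mem_pseudospectrum_iff (P : Fin (m + 1) → Matrix (Fin n) (Fin n) ℂ)
    {w : Fin (m + 1) → ℝ} (hw : ∀ j, 0 ≤ w j) (hw0 : 0 < w 0) {ε : ℝ} {z : ℂ} :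
    z ∈ pseudospectrum P ε w ↔
      ∃ v : EuclideanSpace ℂ (Fin n), ‖v‖ = 1 ∧ ‖polyOperator P z v‖ ≤ ε * weightPoly w ‖z‖ := by
  constructor
  · rintro ⟨Q, hQ, hdet⟩
    obtain ⟨v, hv, hv0⟩ := exists_unit_vector_of_det_eq_zero hdet
    refine ⟨v, hv, ?_⟩
    have h1 : polyOperator P z v = -∑ j : Fin (m + 1), z ^ (j : ℕ) •
        toEuclideanCLM (n := Fin n) (𝕜 := ℂ) (Q j - P j) v := by
      have h2 : polyOperator Q z v = 0 := hv0
      rw [polyOperator_eq_sum] at h2 ⊢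
      simp only [_root_.sum_apply, _root_.smul_apply, map_sub,
        _root_.sub_apply, smul_sub, Finset.sum_sub_distrib] at h2 ⊢
      rw [h2]
      simp
    rw [h1, norm_neg, weightPoly, Finset.mul_sum]
    refine (norm_sum_le _ _).trans (Finset.sum_le_sum fun j _ ↦ ?_)
    rw [norm_smul, norm_pow]
    have h3 := (toEuclideanCLM (n := Fin n) (𝕜 := ℂ) (Q j - P j)).le_opNorm v
    rw [hv, mul_one] at h3
    have h4 : ‖toEuclideanCLM (n := Fin n) (𝕜 := ℂ) (Q j - P j) v‖ ≤ ε * w j := h3.trans (hQ j)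
    calc ‖z‖ ^ (j : ℕ) * ‖toEuclideanCLM (n := Fin n) (𝕜 := ℂ) (Q j - P j) v‖
        ≤ ‖z‖ ^ (j : ℕ) * (ε * w j) := by gcongr
      _ = ε * (w j * ‖z‖ ^ (j : ℕ)) := by ring
  · rintro ⟨v, hv, hle⟩
    obtain ⟨ζ, hζ, hζz⟩ := exists_unimodular_mul_eq_norm z
    set u := polyOperator P z v with hu
    set q := weightPoly w ‖z‖ with hq
    have hqpos : 0 < q := weightPoly_pos hw hw0 (norm_nonneg z)
    set R := InnerProductSpace.rankOne ℂ u v with hR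
    -- The rank-one correction -u v* of P(z) is distributed over the coefficients in proportion to
    -- w_j. The phases ζ^j align the powers of z, so that the terms add up to exactly -u v*.
    set Δ : Fin (m + 1) → Matrix (Fin n) (Fin n) ℂ := fun j ↦
      (-((w j / q : ℝ) : ℂ) * ζ ^ (j : ℕ)) • (toEuclideanCLM (n := Fin n) (𝕜 := ℂ)).symm R with hΔ
    refine ⟨fun j ↦ P j + Δ j, fun j ↦ ?_, ?_⟩
    · rw [add_sub_cancel_left, spectralNorm₂, hΔ]
      simp only [map_smul, StarAlgEquiv.apply_symm_apply]
      rw [norm_smul, norm_mul, norm_pow, hζ, one_pow, mul_one, norm_neg, Complex.norm_real,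
        Real.norm_eq_abs, abs_of_nonneg (div_nonneg (hw j) hqpos.le), hR,
        InnerProductSpace.norm_rankOne, hv, mul_one]
      calc w j / q * ‖u‖ ≤ w j / q * (ε * q) := by
            gcongr; exact div_nonneg (hw j) hqpos.le
        _ = ε * w j := by field_simp
    · refine det_eq_zero_of_toEuclideanCLM_eq_zero (v := v) (by
        rintro rfl; simp at hv) ?_
      change polyOperator (fun j ↦ P j + Δ j) z v = 0
      have hsum : ∑ j : Fin (m + 1), z ^ (j : ℕ) * (-((w j / q : ℝ) : ℂ) * ζ ^ (j : ℕ)) = -1 := by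
        have h1 : ∀ j : Fin (m + 1), z ^ (j : ℕ) * (-((w j / q : ℝ) : ℂ) * ζ ^ (j : ℕ)) =
            -((w j * ‖z‖ ^ (j : ℕ) / q : ℝ) : ℂ) := by
          intro j
          push_cast
          rw [← hζz, mul_pow]
          ring
        rw [Finset.sum_congr rfl fun j _ ↦ h1 j, Finset.sum_neg_distrib, ← Complex.ofReal_sum,
          ← Finset.sum_div, ← weightPoly, ← hq, div_self hqpos.ne', Complex.ofReal_one]
      have h2 : polyOperator (fun j ↦ P j + Δ j) z = polyOperator P z + (-1 : ℂ) • R := by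
        rw [polyOperator_eq_sum, polyOperator_eq_sum, ← hsum, Finset.sum_smul,
          ← Finset.sum_add_distrib]
        refine Finset.sum_congr rfl fun j _ ↦ ?_
        rw [map_add, smul_add, hΔ]
        simp only [map_smul, StarAlgEquiv.apply_symm_apply, smul_smul]
      rw [h2, _root_.add_apply, _root_.smul_apply, ← hu, hR,
        InnerProductSpace.rankOne_apply, inner_self_eq_norm_sq_to_K, hv]
      simp

end Pseudospectrum

/-! ### The boundary separates interior and complement. -/

section PseudospectrumTopology

open Filter Topology Set Matrix

variable {m n : ℕ} {P : Fin (m + 1) → Matrix (Fin n) (Fin n) ℂ} {w : Fin (m + 1) → ℝ} {ε : ℝ}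

lemma continuous_polyOperator_apply (P : Fin (m + 1) → Matrix (Fin n) (Fin n) ℂ) :
    Continuous fun a : ℂ × EuclideanSpace ℂ (Fin n) ↦ polyOperator P a.1 a.2 :=
  ((differentiable_polyOperator P).continuous.comp continuous_fst).clm_apply continuous_snd

lemma continuous_mul_weightPoly_norm (w : Fin (m + 1) → ℝ) (ε : ℝ) :
    Continuous fun z : ℂ ↦ ε * weightPoly w ‖z‖ :=
  continuous_const.mul ((continuous_weightPoly w).comp continuous_norm)

/-- Off the pseudospectrum the strict reverse inequality holds on the compact unit sphere, hence
also for all nearby z. -/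
lemma isClosed_pseudospectrum (hw : ∀ j, 0 ≤ w j) (hw0 : 0 < w 0) :
    IsClosed (pseudospectrum P ε w) := by
  rw [← isOpen_compl_iff, isOpen_iff_mem_nhds]
  intro z hz
  have h1 : ∀ᶠ z' in 𝓝 z, ∀ v ∈ Metric.sphere (0 : EuclideanSpace ℂ (Fin n)) 1,
      ε * weightPoly w ‖z'‖ < ‖polyOperator P z' v‖ := by
    refine (isCompact_sphere _ _).eventually_forall_of_forall_eventually fun v hv ↦ ?_
    refine ContinuousAt.eventually_lt
      ((continuous_mul_weightPoly_norm w ε).comp continuous_fst).continuousAt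
      (continuous_polyOperator_apply P).norm.continuousAt ?_
    by_contra! hle
    exact hz ((mem_pseudospectrum_iff P hw hw0).mpr ⟨v, mem_sphere_zero_iff_norm.mp hv, hle⟩)
  filter_upwards [h1] with z' hz' hmem
  obtain ⟨v, hv, hle⟩ := (mem_pseudospectrum_iff P hw hw0).mp hmem
  exact absurd hle (not_le.mpr (hz' v (mem_sphere_zero_iff_norm.mpr hv)))

lemma mem_interior_pseudospectrum (hw : ∀ j, 0 ≤ w j) (hw0 : 0 < w 0) {z : ℂ}
    {v : EuclideanSpace ℂ (Fin n)} (hv : ‖v‖ = 1)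
    (hlt : ‖polyOperator P z v‖ < ε * weightPoly w ‖z‖) : z ∈ interior (pseudospectrum P ε w) := by
  rw [mem_interior_iff_mem_nhds]
  have hc : Continuous fun z' ↦ ‖polyOperator P z' v‖ :=
    ((continuous_polyOperator_apply P).comp (by fun_prop : Continuous fun z' : ℂ ↦ (z', v))).norm
  filter_upwards [hc.continuousAt.eventually_lt
    (continuous_mul_weightPoly_norm w ε).continuousAt hlt] with z' hz'
  exact (mem_pseudospectrum_iff P hw hw0).mpr ⟨v, hv, hz'.le⟩

/-- A vector violating the bound would, once normalised, satisfy the strict inequality, which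
persists near z and makes z interior. -/
lemma mul_norm_le_norm_polyOperator (hw : ∀ j, 0 ≤ w j) (hw0 : 0 < w 0) {z : ℂ}
    (hz : z ∉ interior (pseudospectrum P ε w)) (v : EuclideanSpace ℂ (Fin n)) :
    ε * weightPoly w ‖z‖ * ‖v‖ ≤ ‖polyOperator P z v‖ := by
  rcases eq_or_ne v 0 with rfl | hv
  · simp
  have hv' : ‖v‖ ≠ 0 := norm_ne_zero_iff.mpr hv
  by_contra! hlt
  refine hz (mem_interior_pseudospectrum hw hw0 (v := (‖v‖⁻¹ : ℂ) • v) ?_ ?_)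
  · rw [norm_smul, norm_inv, Complex.norm_real, norm_norm, inv_mul_cancel₀ hv']
  · rw [map_smul, norm_smul, norm_inv, Complex.norm_real, norm_norm,
      inv_mul_lt_iff₀ (by positivity), mul_comm]
    exact hlt

lemma isUnit_polyOperator (hw : ∀ j, 0 ≤ w j) (hw0 : 0 < w 0) (hε : 0 < ε) {z : ℂ}
    (hz : z ∉ interior (pseudospectrum P ε w)) : IsUnit (polyOperator P z) := by
  have hdet : (matrixPolyEval P z).det ≠ 0 := by
    intro h0
    obtain ⟨v, hv, hv0⟩ := exists_unit_vector_of_det_eq_zero h0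
    have h1 := mul_norm_le_norm_polyOperator hw hw0 hz v
    change polyOperator P z v = 0 at hv0
    rw [hv0, hv, norm_zero, mul_one] at h1
    exact absurd h1 (not_le.mpr (mul_pos hε (weightPoly_pos hw hw0 (norm_nonneg z))))
  exact ((isUnit_iff_isUnit_det _).mpr hdet.isUnit).map
    (toEuclideanCLM (n := Fin n) (𝕜 := ℂ))

/-- By the maximum modulus principle, the pseudospectrum is the closure of its interior. -/
lemma pseudospectrum_subset_closure_interior (hw : ∀ j, 0 ≤ w j) (hw0 : 0 < w 0) (hε : 0 < ε) :
    pseudospectrum P ε w ⊆ closure (interior (pseudospectrum P ε w)) := by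
  intro z₀ hz₀
  by_contra hcl
  have hout : ∀ᶠ z in 𝓝 z₀, z ∉ interior (pseudospectrum P ε w) := by
    filter_upwards [isClosed_closure.isOpen_compl.mem_nhds hcl] with z hz hzi
    exact hz (subset_closure hzi)
  obtain ⟨v₀, hv₀, hle⟩ := (mem_pseudospectrum_iff P hw hw0).mp hz₀
  set u₀ := polyOperator P z₀ v₀ with hu₀
  set q₀ := weightPoly w ‖z₀‖ with hq₀
  have hq₀pos : 0 < q₀ := weightPoly_pos hw hw0 (norm_nonneg _)
  obtain ⟨ζ, hζ, hζz⟩ := exists_unimodular_mul_eq_norm z₀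
  -- R(z) = P(z)⁻¹u₀ is holomorphic near z₀, where no point is interior and P(z) is therefore
  -- invertible with ‖R(z)‖ q(|z|) ≤ q₀.
  set R : ℂ → EuclideanSpace ℂ (Fin n) := fun z ↦ Ring.inverse (polyOperator P z) u₀ with hR
  have hRinv : ∀ z ∉ interior (pseudospectrum P ε w), polyOperator P z (R z) = u₀ := by
    intro z hz
    have h1 := Ring.mul_inverse_cancel _ (isUnit_polyOperator hw hw0 hε hz)
    exact congrArg (fun T : EuclideanSpace ℂ (Fin n) →L[ℂ] EuclideanSpace ℂ (Fin n) ↦ T u₀) h1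
  have hRbound : ∀ z ∉ interior (pseudospectrum P ε w), ‖R z‖ * weightPoly w ‖z‖ ≤ q₀ := by
    intro z hz
    have h1 := mul_norm_le_norm_polyOperator hw hw0 hz (R z)
    rw [hRinv z hz] at h1
    have h2 : ε * (‖R z‖ * weightPoly w ‖z‖) ≤ ε * q₀ := by linarith
    exact le_of_mul_le_mul_left h2 hε
  have hR₀ : R z₀ = v₀ := by
    have h1 := Ring.inverse_mul_cancel _ (isUnit_polyOperator hw hw0 hε hout.self_of_nhds)
    exact congrArg (fun T : EuclideanSpace ℂ (Fin n) →L[ℂ] EuclideanSpace ℂ (Fin n) ↦ T v₀) h1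
  -- A holomorphic stand-in for q(|z|): bounded by it in modulus, and equal to it at z₀ thanks to
  -- the rotation ζ.
  set Wc : ℂ → ℂ := fun z ↦ ∑ j : Fin (m + 1), (w j : ℂ) * (ζ * z) ^ (j : ℕ) with hWc
  have hWcn : ∀ z, ‖Wc z‖ ≤ weightPoly w ‖z‖ := by
    intro z
    refine (norm_sum_le _ _).trans (Finset.sum_le_sum fun j _ ↦ ?_)
    rw [norm_mul, norm_pow, norm_mul, hζ, one_mul, Complex.norm_real, Real.norm_eq_abs,
      abs_of_nonneg (hw j)]
  have hWc₀ : Wc z₀ = q₀ := by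
    simp only [hWc, hζz, hq₀, weightPoly]
    push_cast
    rfl
  set f : ℂ → ℂ := fun z ↦ inner ℂ v₀ (R z) * Wc z with hf
  have hf₀ : f z₀ = q₀ := by
    simp only [hf, hR₀, hWc₀, inner_self_eq_norm_sq_to_K, hv₀]
    simp
  have hcs : ∀ z, ‖inner ℂ v₀ (R z)‖ ≤ ‖R z‖ := fun z ↦ by
    simpa [hv₀] using norm_inner_le_norm (𝕜 := ℂ) v₀ (R z)
  have hfn : ∀ z, ‖f z‖ ≤ ‖R z‖ * weightPoly w ‖z‖ := fun z ↦ by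
    rw [hf, norm_mul]
    exact mul_le_mul (hcs z) (hWcn z) (norm_nonneg _) (norm_nonneg _)
  have hdiff : ∀ᶠ z in 𝓝 z₀, DifferentiableAt ℂ f z := by
    filter_upwards [hout] with z hz
    have h1 : DifferentiableAt ℂ (fun z ↦ Ring.inverse (polyOperator P z)) z := by
      refine DifferentiableAt.comp (g := Ring.inverse) z ?_ (differentiable_polyOperator P z)
      exact differentiableAt_inverse (isUnit_polyOperator hw hw0 hε hz)
    have h2 : DifferentiableAt ℂ R z := h1.clm_apply (differentiableAt_const u₀)
    have h3 : DifferentiableAt ℂ Wc z := by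
      simp only [hWc]
      fun_prop
    exact ((innerSL ℂ v₀).differentiableAt.comp z h2).mul h3
  have hmax : IsLocalMax (norm ∘ f) z₀ := by
    filter_upwards [hout] with z hz
    rw [Function.comp_apply, Function.comp_apply, hf₀, Complex.norm_real, Real.norm_eq_abs,
      abs_of_pos hq₀pos]
    exact (hfn z).trans (hRbound z hz)
  -- By the maximum modulus principle f is constant near z₀. Then ‖R(z)‖ q(|z|) ≥ q₀, and the
  -- normalised R(z) puts every nearby z in the pseudospectrum, contradicting that z₀ is not
  -- interior.
  have hconst := Complex.eventually_eq_of_isLocalMax_norm hdiff hmax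
  refine hout.self_of_nhds (mem_interior_iff_mem_nhds.mpr ?_)
  filter_upwards [hconst, hout] with z hz hzout
  have h1 : q₀ ≤ ‖R z‖ * weightPoly w ‖z‖ := by
    have := hfn z
    rwa [hz, hf₀, Complex.norm_real, Real.norm_eq_abs, abs_of_pos hq₀pos] at this
  have hRpos : 0 < ‖R z‖ := by
    rcases (norm_nonneg (R z)).eq_or_lt with h2 | h2
    · rw [← h2, zero_mul] at h1
      exact absurd h1 (not_le.mpr hq₀pos)
    · exact h2
  refine (mem_pseudospectrum_iff P hw hw0).mpr ⟨(‖R z‖⁻¹ : ℂ) • R z, ?_, ?_⟩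
  · rw [norm_smul, norm_inv, Complex.norm_real, norm_norm, inv_mul_cancel₀ hRpos.ne']
  · rw [map_smul, norm_smul, norm_inv, Complex.norm_real, norm_norm, hRinv z hzout,
      inv_mul_le_iff₀ hRpos]
    calc ‖u₀‖ ≤ ε * q₀ := hle
      _ ≤ ε * (‖R z‖ * weightPoly w ‖z‖) := by gcongr
      _ = ‖R z‖ * (ε * weightPoly w ‖z‖) := by ring

/-- The boundary of the pseudospectrum separates its interior from its complement. -/
lemma isSeparating_frontier_pseudospectrum (hw : ∀ j, 0 ≤ w j) (hw0 : 0 < w 0) (hε : 0 < ε) :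
    IsSeparating (frontier (pseudospectrum P ε w)) (interior (pseudospectrum P ε w))
      (pseudospectrum P ε w)ᶜ := by
  have hcl : IsClosed (pseudospectrum P ε w) := isClosed_pseudospectrum hw hw0
  refine ⟨isOpen_interior, hcl.isOpen_compl, ?_, ?_, ?_, ?_⟩
  · exact disjoint_compl_right.mono_left interior_subset
  · rw [hcl.frontier_eq, compl_union, compl_compl, inter_comm, sdiff_eq]
  · exact hcl.frontier_subset.trans (pseudospectrum_subset_closure_interior hw hw0 hε)
  · rw [frontier_eq_closure_inter_closure]
    exact inter_subset_right

end PseudospectrumTopology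

/-! ### The determinantal equation of the boundary. -/

section BoundaryEquation

open Filter Topology Set Matrix
open scoped ComplexOrder

variable {m n : ℕ}

/-- The functions on the plane of the form `a + |z| b`, with `a`, `b` polynomials in the real
coordinates. -/
def polyNormSubring : Subring (ℂ → ℂ) where
  carrier := {h | ∃ a b : MvPolynomial (Fin 2) ℂ, ∀ z : ℂ, h z =
    MvPolynomial.eval ![(z.re : ℂ), (z.im : ℂ)] a +
      ‖z‖ * MvPolynomial.eval ![(z.re : ℂ), (z.im : ℂ)] b}
  zero_mem' := ⟨0, 0, fun z ↦ by simp⟩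
  one_mem' := ⟨1, 0, fun z ↦ by simp⟩
  add_mem' := by
    rintro f g ⟨a, b, hf⟩ ⟨a', b', hg⟩
    refine ⟨a + a', b + b', fun z ↦ ?_⟩
    rw [Pi.add_apply, hf, hg, map_add, map_add]
    ring
  neg_mem' := by
    rintro f ⟨a, b, hf⟩
    refine ⟨-a, -b, fun z ↦ ?_⟩
    rw [Pi.neg_apply, hf, map_neg, map_neg]
    ring
  mul_mem' := by
    rintro f g ⟨a, b, hf⟩ ⟨a', b', hg⟩
    -- The identity |z|² = x² + y² keeps products in this form.
    refine ⟨a * a' + (MvPolynomial.X 0 ^ 2 + MvPolynomial.X 1 ^ 2) * (b * b'),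
      a * b' + b * a', fun z ↦ ?_⟩
    have h1 : (‖z‖ : ℂ) ^ 2 = (z.re : ℂ) ^ 2 + (z.im : ℂ) ^ 2 := by
      rw [← Complex.ofReal_pow, Complex.sq_norm, Complex.normSq_apply]
      push_cast
      ring
    rw [Pi.mul_apply, hf, hg]
    simp only [map_add, map_mul, map_pow, MvPolynomial.eval_X, cons_val_zero, cons_val_one]
    linear_combination (MvPolynomial.eval ![(z.re : ℂ), (z.im : ℂ)] b) *
      (MvPolynomial.eval ![(z.re : ℂ), (z.im : ℂ)] b') * h1

lemma const_mem_polyNormSubring (c : ℂ) : (fun _ ↦ c) ∈ polyNormSubring :=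
  ⟨MvPolynomial.C c, 0, fun z ↦ by simp⟩

lemma id_mem_polyNormSubring : (fun z ↦ z) ∈ polyNormSubring := by
  refine ⟨MvPolynomial.X 0 + MvPolynomial.C Complex.I * MvPolynomial.X 1, 0, fun z ↦ ?_⟩
  simp [mul_comm Complex.I, Complex.re_add_im]

lemma conj_mem_polyNormSubring : (fun z : ℂ ↦ star z) ∈ polyNormSubring := by
  refine ⟨MvPolynomial.X 0 - MvPolynomial.C Complex.I * MvPolynomial.X 1, 0, fun z ↦ ?_⟩
  apply Complex.ext <;> simp

lemma norm_mem_polyNormSubring : (fun z : ℂ ↦ (‖z‖ : ℂ)) ∈ polyNormSubring :=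
  ⟨0, 1, fun z ↦ by simp⟩

lemma sum_fun_mem_polyNormSubring {ι : Type*} (s : Finset ι) {f : ι → ℂ → ℂ}
    (hf : ∀ i ∈ s, f i ∈ polyNormSubring) : (fun z ↦ ∑ i ∈ s, f i z) ∈ polyNormSubring := by
  have := polyNormSubring.sum_mem hf
  convert this using 1
  ext z
  simp

/-- The determinant is taken over the subring itself; evaluation at z is a ring homomorphism and
commutes with it. -/
lemma det_mem_polyNormSubring {N : ℂ → Matrix (Fin n) (Fin n) ℂ}
    (hN : ∀ i j, (fun z ↦ N z i j) ∈ polyNormSubring) :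
    (fun z ↦ (N z).det) ∈ polyNormSubring := by
  let N' : Matrix (Fin n) (Fin n) polyNormSubring := fun i j ↦ ⟨_, hN i j⟩
  have h1 : (fun z ↦ (N z).det) = (N'.det : polyNormSubring) := by
    ext z
    have := RingHom.map_det ((Pi.evalRingHom (fun _ : ℂ ↦ ℂ) z).comp polyNormSubring.subtype) N'
    exact this.symm
  rw [h1]
  exact N'.det.2

/-- The matrix `P(z)* P(z) - ε² q(|z|)² I`, which is singular at the boundary points of the
pseudospectrum. -/
noncomputable def boundaryMatrix (P : Fin (m + 1) → Matrix (Fin n) (Fin n) ℂ) (ε : ℝ) (w : Fin (m + 1) → ℝ)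
    (z : ℂ) : Matrix (Fin n) (Fin n) ℂ :=
  (matrixPolyEval P z)ᴴ * matrixPolyEval P z - (((ε * weightPoly w ‖z‖) ^ 2 : ℝ) : ℂ) • 1

lemma det_boundaryMatrix_mem (P : Fin (m + 1) → Matrix (Fin n) (Fin n) ℂ) (ε : ℝ)
    (w : Fin (m + 1) → ℝ) : (fun z ↦ (boundaryMatrix P ε w z).det) ∈ polyNormSubring := by
  have hP : ∀ i j, (fun z ↦ matrixPolyEval P z i j) ∈ polyNormSubring := by
    intro i j
    have : (fun z ↦ matrixPolyEval P z i j) = fun z ↦ ∑ l : Fin (m + 1), z ^ (l : ℕ) * P l i j := by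
      ext z
      simp [matrixPolyEval, Matrix.sum_apply]
    rw [this]
    exact sum_fun_mem_polyNormSubring _ fun l _ ↦ polyNormSubring.mul_mem
      (polyNormSubring.pow_mem id_mem_polyNormSubring _) (const_mem_polyNormSubring _)
  have hPs : ∀ i j, (fun z ↦ star (matrixPolyEval P z i j)) ∈ polyNormSubring := by
    intro i j
    have : (fun z ↦ star (matrixPolyEval P z i j)) =
        fun z ↦ ∑ l : Fin (m + 1), (star z) ^ (l : ℕ) * star (P l i j) := by
      ext z
      simp [matrixPolyEval, Matrix.sum_apply]
    rw [this]
    exact sum_fun_mem_polyNormSubring _ fun l _ ↦ polyNormSubring.mul_mem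
      (polyNormSubring.pow_mem conj_mem_polyNormSubring _) (const_mem_polyNormSubring _)
  have hq : (fun z : ℂ ↦ (((ε * weightPoly w ‖z‖) ^ 2 : ℝ) : ℂ)) ∈ polyNormSubring := by
    have : (fun z : ℂ ↦ (((ε * weightPoly w ‖z‖) ^ 2 : ℝ) : ℂ)) =
        (fun z ↦ (ε : ℂ) * ∑ l : Fin (m + 1), (w l : ℂ) * (‖z‖ : ℂ) ^ (l : ℕ)) ^ 2 := by
      ext z
      simp [weightPoly]
    rw [this]
    exact polyNormSubring.pow_mem (polyNormSubring.mul_mem (const_mem_polyNormSubring _)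
      (sum_fun_mem_polyNormSubring _ fun l _ ↦ polyNormSubring.mul_mem
        (const_mem_polyNormSubring _) (polyNormSubring.pow_mem norm_mem_polyNormSubring _))) 2
  refine det_mem_polyNormSubring fun i j ↦ ?_
  have : (fun z ↦ boundaryMatrix P ε w z i j) =
      (fun z ↦ ∑ l, star (matrixPolyEval P z l i) * matrixPolyEval P z l j) -
        (fun z : ℂ ↦ (((ε * weightPoly w ‖z‖) ^ 2 : ℝ) : ℂ)) *
          fun _ ↦ (1 : Matrix (Fin n) (Fin n) ℂ) i j := by
    ext z
    simp [boundaryMatrix, Matrix.mul_apply]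
  rw [this]
  exact polyNormSubring.sub_mem (sum_fun_mem_polyNormSubring _ fun l _ ↦
    polyNormSubring.mul_mem (hPs l i) (hP l j))
    (polyNormSubring.mul_mem hq (const_mem_polyNormSubring _))

lemma toEuclideanCLM_boundaryMatrix (P : Fin (m + 1) → Matrix (Fin n) (Fin n) ℂ) (ε : ℝ)
    (w : Fin (m + 1) → ℝ) (z : ℂ) :
    toEuclideanCLM (n := Fin n) (𝕜 := ℂ) (boundaryMatrix P ε w z) =
      ContinuousLinearMap.adjoint (polyOperator P z) * polyOperator P z -
        (((ε * weightPoly w ‖z‖) ^ 2 : ℝ) : ℂ) • 1 := by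
  rw [boundaryMatrix, map_sub, map_mul, map_smul, map_one, ← star_eq_conjTranspose, map_star,
    ContinuousLinearMap.star_eq_adjoint]
  rfl

lemma inner_boundaryMatrix (P : Fin (m + 1) → Matrix (Fin n) (Fin n) ℂ) (ε : ℝ)
    (w : Fin (m + 1) → ℝ) (z : ℂ) (v : EuclideanSpace ℂ (Fin n)) :
    inner ℂ v (toEuclideanCLM (n := Fin n) (𝕜 := ℂ) (boundaryMatrix P ε w z) v) =
      ((‖polyOperator P z v‖ ^ 2 - (ε * weightPoly w ‖z‖ * ‖v‖) ^ 2 : ℝ) : ℂ) := by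
  rw [toEuclideanCLM_boundaryMatrix, _root_.sub_apply, inner_sub_right,
    mul_apply_eq_comp, ContinuousLinearMap.adjoint_inner_right,
    inner_self_eq_norm_sq_to_K, _root_.smul_apply, inner_smul_right,
    one_apply_eq_self, inner_self_eq_norm_sq_to_K]
  push_cast
  simp only [Complex.coe_algebraMap]
  ring

/-- A unit kernel vector would give ‖P(z)v‖ = ε q(|z|). This supplies a point where the boundary
equation is not satisfied. -/
lemma det_boundaryMatrix_ne_zero {P : Fin (m + 1) → Matrix (Fin n) (Fin n) ℂ} {ε : ℝ}
    {w : Fin (m + 1) → ℝ} (hw : ∀ j, 0 ≤ w j) (hw0 : 0 < w 0) (hε : 0 < ε) {z : ℂ}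
    (hz : z ∉ pseudospectrum P ε w) : (boundaryMatrix P ε w z).det ≠ 0 := by
  intro h0
  obtain ⟨v, hv, hv0⟩ := exists_unit_vector_of_det_eq_zero h0
  have h1 := inner_boundaryMatrix P ε w z v
  rw [hv0, inner_zero_right, hv, mul_one] at h1
  have h2 : ‖polyOperator P z v‖ ^ 2 - (ε * weightPoly w ‖z‖) ^ 2 = 0 := by exact_mod_cast h1.symm
  refine hz ((mem_pseudospectrum_iff P hw hw0).mpr ⟨v, hv, ?_⟩)
  have h3 := mul_pos hε (weightPoly_pos hw hw0 (norm_nonneg z))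
  exact abs_le_of_sq_le_sq' (by linarith) h3.le |>.2

/-- Not being interior makes the Hermitian matrix positive semidefinite, and membership provides a
unit vector on which its form vanishes. For a semidefinite matrix such a vector lies in the kernel.
-/
lemma det_boundaryMatrix_eq_zero {P : Fin (m + 1) → Matrix (Fin n) (Fin n) ℂ} {ε : ℝ}
    {w : Fin (m + 1) → ℝ} (hw : ∀ j, 0 ≤ w j) (hw0 : 0 < w 0) (hε : 0 < ε) {z : ℂ}
    (hz : z ∈ frontier (pseudospectrum P ε w)) : (boundaryMatrix P ε w z).det = 0 := by
  have hcl : IsClosed (pseudospectrum P ε w) := isClosed_pseudospectrum hw hw0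
  rw [hcl.frontier_eq] at hz
  obtain ⟨v, hv, hle⟩ := (mem_pseudospectrum_iff P hw hw0).mp hz.1
  have hlow := mul_norm_le_norm_polyOperator hw hw0 hz.2
  have hq := mul_pos hε (weightPoly_pos hw hw0 (norm_nonneg z))
  set B := toEuclideanCLM (n := Fin n) (𝕜 := ℂ) (boundaryMatrix P ε w z) with hB
  have hpos : B.IsPositive := by
    rw [ContinuousLinearMap.isPositive_iff_complex]
    intro x
    have h1 : inner ℂ (B x) x =
        ((‖polyOperator P z x‖ ^ 2 - (ε * weightPoly w ‖z‖ * ‖x‖) ^ 2 : ℝ) : ℂ) := by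
      rw [← inner_conj_symm, inner_boundaryMatrix, Complex.conj_ofReal]
    rw [h1]
    have h2 : 0 ≤ ‖polyOperator P z x‖ ^ 2 - (ε * weightPoly w ‖z‖ * ‖x‖) ^ 2 :=
      sub_nonneg.mpr (pow_le_pow_left₀ (mul_nonneg hq.le (norm_nonneg x)) (hlow x) 2)
    exact ⟨rfl, h2⟩
  have hpsd : (boundaryMatrix P ε w z).PosSemidef := by
    rw [← Matrix.isPositive_toEuclideanLin_iff, ← coe_toEuclideanCLM_eq_toEuclideanLin]
    exact hpos.toLinearMap
  have h0 : inner ℂ v (B v) = 0 := by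
    rw [inner_boundaryMatrix, hv, mul_one]
    have := le_antisymm hle (by simpa [hv] using hlow v)
    rw [this]
    simp
  have hv0 : v ≠ 0 := fun h ↦ by simp [h] at hv
  refine det_eq_zero_of_toEuclideanCLM_eq_zero hv0 ?_
  apply (WithLp.ofLp_injective 2)
  rw [ofLp_toEuclideanCLM]
  refine (hpsd.dotProduct_mulVec_zero_iff _).mp ?_
  rw [EuclideanSpace.inner_eq_star_dotProduct, dotProduct_comm, hB, ofLp_toEuclideanCLM] at h0
  exact h0

end BoundaryEquation

/-! ### Elimination of |z| and a real polynomial equation. -/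

section RealEquation

open Filter Topology Set

open Polynomial in
/-- A relation `a² = (X² + c²) b²` with `c ≠ 0` is trivial, since the right-hand side has odd
order at `c i`. -/
lemma eq_zero_of_sq_eq_mul_sq {a b : ℂ[X]} {c : ℝ} (hc : c ≠ 0)
    (h : a ^ 2 = (X ^ 2 + C ((c : ℂ) ^ 2)) * b ^ 2) : a = 0 ∧ b = 0 := by
  have hfac : (X ^ 2 + C ((c : ℂ) ^ 2) : ℂ[X]) =
      (X - C (c * Complex.I)) * (X - C (-(c * Complex.I))) := by
    have hI : C Complex.I * C Complex.I = (-1 : ℂ[X]) := by rw [← C_mul]; simp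
    simp only [C_pow, C_mul, C_neg]
    linear_combination (C (c : ℂ)) ^ 2 * hI
  by_cases hb : b = 0
  · subst hb
    exact ⟨by simpa using h, rfl⟩
  exfalso
  have hne : (X - C (-(c * Complex.I)) : ℂ[X]) ≠ 0 := X_sub_C_ne_zero _
  have hne' : (X - C (c * Complex.I) : ℂ[X]) ≠ 0 := X_sub_C_ne_zero _
  have hb2 : b ^ 2 ≠ 0 := pow_ne_zero 2 hb
  have h1 := congrArg (rootMultiplicity ((c : ℂ) * Complex.I)) h
  have ha : a ≠ 0 := by
    rintro rfl
    rw [hfac] at h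
    exact mul_ne_zero (mul_ne_zero hne' hne) hb2 (by simpa using h.symm)
  have h2 : ((c : ℂ) * Complex.I) ≠ -(c * Complex.I) := by
    intro h
    have : (c : ℂ) * Complex.I = 0 := self_eq_neg.mp h
    simp [hc] at this
  have h3 : rootMultiplicity ((c : ℂ) * Complex.I) (X - C (-(c * Complex.I))) = 0 := by
    apply rootMultiplicity_eq_zero
    rw [IsRoot, eval_sub, eval_X, eval_C, sub_eq_zero]
    exact h2
  rw [hfac, rootMultiplicity_mul (mul_ne_zero (mul_ne_zero hne' hne) hb2),
    rootMultiplicity_mul (mul_ne_zero hne' hne), h3, rootMultiplicity_X_sub_C_self, sq, sq,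
    rootMultiplicity_mul (mul_ne_zero ha ha), rootMultiplicity_mul (mul_ne_zero hb hb)] at h1
  omega

/-- The real and imaginary parts of a complex polynomial in real variables are real polynomials. -/
lemma exists_re_im_polynomials (p : MvPolynomial (Fin 2) ℂ) :
    ∃ g₁ g₂ : MvPolynomial (Fin 2) ℝ, ∀ x y : ℝ, MvPolynomial.eval ![(x : ℂ), (y : ℂ)] p =
      ⟨MvPolynomial.eval ![x, y] g₁, MvPolynomial.eval ![x, y] g₂⟩ := by
  induction p using MvPolynomial.induction_on with
  | C c =>
    exact ⟨MvPolynomial.C c.re, MvPolynomial.C c.im, fun x y ↦ by simp⟩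
  | add p q hp hq =>
    obtain ⟨g₁, g₂, hg⟩ := hp
    obtain ⟨k₁, k₂, hk⟩ := hq
    refine ⟨g₁ + k₁, g₂ + k₂, fun x y ↦ ?_⟩
    rw [map_add, hg, hk]
    apply Complex.ext <;> simp
  | mul_X p i hp =>
    obtain ⟨g₁, g₂, hg⟩ := hp
    refine ⟨g₁ * MvPolynomial.X i, g₂ * MvPolynomial.X i, fun x y ↦ ?_⟩
    rw [map_mul, hg, MvPolynomial.eval_X]
    fin_cases i <;> apply Complex.ext <;> simp

open Polynomial in
/-- The zeros of a function `a + |z| b` on the plane, not identically zero, lie on a real algebraic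
curve. -/
lemma exists_polynomial_of_mem_polyNormSubring {F : ℂ → ℂ} (hF : F ∈ polyNormSubring) {z₀ : ℂ}
    (hz₀ : F z₀ ≠ 0) : ∃ f : MvPolynomial (Fin 2) ℝ, f ≠ 0 ∧
      ∀ z, F z = 0 → MvPolynomial.eval ![z.re, z.im] f = 0 := by
  obtain ⟨a, b, hab⟩ := hF
  -- This is (a + |z|b)(a - |z|b) as a polynomial in x, y; its coefficients are complex, so the
  -- squares of its real and imaginary parts are added.
  let f₀ := a ^ 2 - (MvPolynomial.X 0 ^ 2 + MvPolynomial.X 1 ^ 2) * b ^ 2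
  have hf₀ : ∀ x y : ℂ, MvPolynomial.eval ![x, y] f₀ = MvPolynomial.eval ![x, y] a ^ 2 -
      (x ^ 2 + y ^ 2) * MvPolynomial.eval ![x, y] b ^ 2 := by
    intro x y
    simp [f₀]
  obtain ⟨g₁, g₂, hg⟩ := exists_re_im_polynomials f₀
  refine ⟨g₁ ^ 2 + g₂ ^ 2, ?_, ?_⟩
  · intro h0
    have hzero : ∀ x y : ℝ, MvPolynomial.eval ![(x : ℂ), (y : ℂ)] f₀ = 0 := by
      intro x y
      have h1 := congrArg (MvPolynomial.eval ![x, y]) h0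
      rw [map_add, map_pow, map_pow, map_zero] at h1
      rw [hg]
      apply Complex.ext
      · change MvPolynomial.eval ![x, y] g₁ = 0
        nlinarith [sq_nonneg (MvPolynomial.eval ![x, y] g₁), sq_nonneg (MvPolynomial.eval ![x, y] g₂)]
      · change MvPolynomial.eval ![x, y] g₂ = 0
        nlinarith [sq_nonneg (MvPolynomial.eval ![x, y] g₁), sq_nonneg (MvPolynomial.eval ![x, y] g₂)]
    -- If f₀ vanished identically, restricting to the horizontal line y = z.im ≠ 0 would give a² =
    -- (x² + y²)b² in ℂ[x], so a and b vanish on that line.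
    have hline : ∀ z : ℂ, z.im ≠ 0 → F z = 0 := by
      intro z hz
      have he : ∀ (r : MvPolynomial (Fin 2) ℂ) (x : ℂ),
          (MvPolynomial.aeval ![(X : ℂ[X]), C (z.im : ℂ)] r).eval x =
            MvPolynomial.eval ![x, (z.im : ℂ)] r := by
        intro r x
        induction r using MvPolynomial.induction_on with
        | C c => simp
        | add p q hp hq => simp [hp, hq]
        | mul_X p i hp =>
          rw [map_mul, map_mul, eval_mul, hp]
          fin_cases i <;> simp
      obtain ⟨h1, h2⟩ := eq_zero_of_sq_eq_mul_sq hz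
        (a := MvPolynomial.aeval ![(X : ℂ[X]), C (z.im : ℂ)] a)
        (b := MvPolynomial.aeval ![(X : ℂ[X]), C (z.im : ℂ)] b) (by
          refine eq_of_infinite_eval_eq _ _ ?_
          refine Infinite.mono ?_ (infinite_range_of_injective Complex.ofReal_injective)
          rintro _ ⟨x, rfl⟩
          have := hzero x z.im
          rw [hf₀, sub_eq_zero] at this
          simpa [he] using this)
      rw [hab, ← he, ← he, h1, h2]
      simp
    have hcont : Continuous F := by
      have hc : ∀ r : MvPolynomial (Fin 2) ℂ,
          Continuous fun z : ℂ ↦ MvPolynomial.eval ![(z.re : ℂ), (z.im : ℂ)] r := by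
        intro r
        refine (MvPolynomial.continuous_eval r).comp (continuous_pi fun i ↦ ?_)
        fin_cases i
        · exact Complex.continuous_ofReal.comp Complex.continuous_re
        · exact Complex.continuous_ofReal.comp Complex.continuous_im
      rw [funext hab]
      exact (hc a).add ((Complex.continuous_ofReal.comp continuous_norm).mul (hc b))
    -- Continuity extends the vanishing of F to the real axis, where z₀ may lie.
    have hlim : Tendsto (fun t : ℝ ↦ F (z₀ + t * Complex.I)) (𝓝[≠] 0) (𝓝 (F z₀)) := by
      have h1 : Continuous fun t : ℝ ↦ F (z₀ + t * Complex.I) := by fun_prop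
      have h2 := h1.tendsto 0
      simp only [Complex.ofReal_zero, zero_mul, add_zero] at h2
      exact h2.mono_left nhdsWithin_le_nhds
    have hev : ∀ᶠ t : ℝ in 𝓝[≠] 0, (z₀ + t * Complex.I).im ≠ 0 := by
      by_cases hi : z₀.im = 0
      · filter_upwards [self_mem_nhdsWithin] with t ht
        simpa [hi] using ht
      · have h1 : Continuous fun t : ℝ ↦ (z₀ + t * Complex.I).im := by fun_prop
        have h2 := h1.continuousAt.eventually_ne (x := 0) (y := 0) (by simpa using hi)
        exact h2.filter_mono nhdsWithin_le_nhds
    refine hz₀ (tendsto_nhds_unique hlim ?_)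
    refine tendsto_const_nhds.congr' ?_
    filter_upwards [hev] with t ht
    exact (hline _ ht).symm
  · intro z hz
    have h1 : MvPolynomial.eval ![(z.re : ℂ), (z.im : ℂ)] f₀ = 0 := by
      have h2 : (‖z‖ : ℂ) ^ 2 = (z.re : ℂ) ^ 2 + (z.im : ℂ) ^ 2 := by
        rw [← Complex.ofReal_pow, Complex.sq_norm, Complex.normSq_apply]
        push_cast
        ring
      rw [hab] at hz
      rw [hf₀, ← h2]
      linear_combination (MvPolynomial.eval ![(z.re : ℂ), (z.im : ℂ)] a -
        ‖z‖ * MvPolynomial.eval ![(z.re : ℂ), (z.im : ℂ)] b) * hz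
    rw [hg] at h1
    have h2 : MvPolynomial.eval ![z.re, z.im] g₁ = 0 := congrArg Complex.re h1
    have h3 : MvPolynomial.eval ![z.re, z.im] g₂ = 0 := congrArg Complex.im h1
    simp [h2, h3]

/-- The boundary of the pseudospectrum lies on a real algebraic curve. -/
theorem exists_polynomial_frontier_pseudospectrum {m n : ℕ}
    {P : Fin (m + 1) → Matrix (Fin n) (Fin n) ℂ} {ε : ℝ} {w : Fin (m + 1) → ℝ}
    (hw : ∀ j, 0 ≤ w j) (hw0 : 0 < w 0) (hε : 0 < ε) (hΛ : pseudospectrum P ε w ≠ univ) :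
    ∃ f : MvPolynomial (Fin 2) ℝ, 0 < f.totalDegree ∧
      ∀ z ∈ frontier (pseudospectrum P ε w), MvPolynomial.eval ![z.re, z.im] f = 0 := by
  obtain ⟨z₀, hz₀⟩ := (ne_univ_iff_exists_notMem _).mp hΛ
  obtain ⟨f, hf, hfz⟩ := exists_polynomial_of_mem_polyNormSubring (det_boundaryMatrix_mem P ε w)
    (det_boundaryMatrix_ne_zero hw hw0 hε hz₀)
  -- The factor X 0 guarantees positive degree even if f is a nonzero constant.
  refine ⟨f * MvPolynomial.X 0, ?_, fun z hz ↦ ?_⟩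
  · rw [MvPolynomial.totalDegree_mul_of_isDomain hf (MvPolynomial.X_ne_zero _),
      MvPolynomial.totalDegree_X]
    omega
  · rw [map_mul, hfz z (det_boundaryMatrix_eq_zero hw hw0 hε hz), zero_mul]

end RealEquation

/-! ### Linear change of coordinates to a monic equation. -/

section Rotation

open Polynomial

/-- The polynomial in `y` over `ℝ[x]` obtained from `f` by the linear change of coordinates
`(α y - β x, β y + α x)`. -/
noncomputable def rotatedPoly (f : MvPolynomial (Fin 2) ℝ) (α β : ℝ) : ℝ[X][X] :=
  MvPolynomial.aeval ![C (C α) * X - C (C β * X), C (C β) * X + C (C α * X)] f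

lemma evalEval_rotatedPoly (f : MvPolynomial (Fin 2) ℝ) (α β x y : ℝ) :
    (rotatedPoly f α β).evalEval x y =
      MvPolynomial.eval ![α * y - β * x, β * y + α * x] f := by
  induction f using MvPolynomial.induction_on with
  | C c => simp [rotatedPoly, evalEval, Polynomial.algebraMap_apply]
  | add p q hp hq =>
    rw [rotatedPoly, map_add, evalEval_add, map_add, ← hp, ← hq, rotatedPoly, rotatedPoly]
  | mul_X p i hp =>
    rw [rotatedPoly, map_mul, evalEval_mul, ← rotatedPoly, hp, map_mul]
    fin_cases i <;> simp [evalEval]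

lemma natDegree_linear_pow_le (a b : ℝ[X]) (k : ℕ) :
    ((C a * X + C b : ℝ[X][X]) ^ k).natDegree ≤ k := by
  simpa using natDegree_pow_le_of_le k (natDegree_linear_le (a := a) (b := b))

lemma coeff_linear_pow (a b : ℝ[X]) (k : ℕ) :
    ((C a * X + C b : ℝ[X][X]) ^ k).coeff k = a ^ k := by
  have := coeff_pow_of_natDegree_le (p := (C a * X + C b : ℝ[X][X])) (n := 1) (m := k)
    natDegree_linear_le
  simpa using this

lemma rotatedPoly_monomial (s : Fin 2 →₀ ℕ) (c α β : ℝ) :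
    rotatedPoly (MvPolynomial.monomial s c) α β =
      C (C c) * ((C (C α) * X + C (-(C β * X))) ^ s 0 * (C (C β) * X + C (C α * X)) ^ s 1) := by
  rw [rotatedPoly, MvPolynomial.aeval_monomial, Finsupp.prod_fintype _ _ (by simp)]
  simp [Fin.prod_univ_two, Polynomial.algebraMap_apply, sub_eq_add_neg]

lemma natDegree_rotatedPoly_monomial_le (s : Fin 2 →₀ ℕ) (c α β : ℝ) :
    (rotatedPoly (MvPolynomial.monomial s c) α β).natDegree ≤ s 0 + s 1 := by
  rw [rotatedPoly_monomial]
  exact (natDegree_C_mul_le _ _).trans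
    (natDegree_mul_le_of_le (natDegree_linear_pow_le _ _ _) (natDegree_linear_pow_le _ _ _))

lemma coeff_rotatedPoly_monomial (s : Fin 2 →₀ ℕ) (c α β : ℝ) :
    (rotatedPoly (MvPolynomial.monomial s c) α β).coeff (s 0 + s 1) =
      C (MvPolynomial.eval ![α, β] (MvPolynomial.monomial s c)) := by
  rw [rotatedPoly_monomial, coeff_C_mul,
    coeff_mul_add_eq_of_natDegree_le (natDegree_linear_pow_le _ _ _)
      (natDegree_linear_pow_le _ _ _),
    coeff_linear_pow, coeff_linear_pow, MvPolynomial.eval_monomial,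
    Finsupp.prod_fintype _ _ (by simp)]
  simp [Fin.prod_univ_two]

lemma rotatedPoly_eq_sum (f : MvPolynomial (Fin 2) ℝ) (α β : ℝ) :
    rotatedPoly f α β =
      ∑ s ∈ f.support, rotatedPoly (MvPolynomial.monomial s (f.coeff s)) α β := by
  conv_lhs => rw [f.as_sum, rotatedPoly, map_sum]
  rfl

lemma degree_fin_two (s : Fin 2 →₀ ℕ) : s.degree = s 0 + s 1 := by
  rw [Finsupp.degree_eq_sum, Fin.sum_univ_two]

lemma natDegree_rotatedPoly_le (f : MvPolynomial (Fin 2) ℝ) (α β : ℝ) :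
    (rotatedPoly f α β).natDegree ≤ f.totalDegree := by
  rw [rotatedPoly_eq_sum]
  refine natDegree_sum_le_of_forall_le _ _ fun s hs ↦
    (natDegree_rotatedPoly_monomial_le _ _ _ _).trans ?_
  rw [← degree_fin_two]
  exact MvPolynomial.le_totalDegree hs

/-- Only monomials of top degree reach this power of y. Their contribution is the value of the top
form at (α, β), free of x, so a nonzero value can be scaled to 1. -/
lemma coeff_rotatedPoly (f : MvPolynomial (Fin 2) ℝ) (α β : ℝ) :
    (rotatedPoly f α β).coeff f.totalDegree =
      C (MvPolynomial.eval ![α, β] (MvPolynomial.homogeneousComponent f.totalDegree f)) := by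
  rw [rotatedPoly_eq_sum, finsetSum_coeff, MvPolynomial.homogeneousComponent_apply, map_sum,
    map_sum, Finset.sum_filter]
  refine Finset.sum_congr rfl fun s hs ↦ ?_
  split_ifs with h
  · rw [← h, degree_fin_two, coeff_rotatedPoly_monomial]
  · refine coeff_eq_zero_of_natDegree_lt ((natDegree_rotatedPoly_monomial_le _ _ _ _).trans_lt ?_)
    rw [← degree_fin_two]
    exact lt_of_le_of_ne (MvPolynomial.le_totalDegree hs) h

lemma homogeneousComponent_totalDegree_ne_zero {f : MvPolynomial (Fin 2) ℝ} (hf : f ≠ 0) :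
    MvPolynomial.homogeneousComponent f.totalDegree f ≠ 0 := by
  obtain ⟨s, hs, hsd⟩ := Finset.exists_mem_eq_sup f.support
    (MvPolynomial.support_nonempty.mpr hf) (fun s ↦ s.degree)
  intro h0
  have h1 := congrArg (MvPolynomial.coeff s) h0
  have hsd' : s.degree = f.totalDegree := hsd.symm
  rw [MvPolynomial.coeff_homogeneousComponent, if_pos hsd', MvPolynomial.coeff_zero] at h1
  exact MvPolynomial.mem_support_iff.mp hs h1

/-- After a linear change of coordinates, a real algebraic curve lies on the zero set of a
polynomial that is monic in the second coordinate. -/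
lemma exists_rotation_monic {f : MvPolynomial (Fin 2) ℝ} (hf : 0 < f.totalDegree) :
    ∃ α β : ℝ, (⟨α, β⟩ : ℂ) ≠ 0 ∧ ∃ p : ℝ[X][X], p.Monic ∧
      ∀ x y, MvPolynomial.eval ![α * y - β * x, β * y + α * x] f = 0 → p.evalEval x y = 0 := by
  have hf0 : f ≠ 0 := by
    rintro rfl
    simp at hf
  obtain ⟨v, hv⟩ : ∃ v : Fin 2 → ℝ,
      MvPolynomial.eval v (MvPolynomial.homogeneousComponent f.totalDegree f) ≠ 0 := by
    by_contra! h
    exact homogeneousComponent_totalDegree_ne_zero hf0 (MvPolynomial.funext fun v ↦ by simp [h v])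
  have hvv : v = ![v 0, v 1] := by
    ext i
    fin_cases i <;> rfl
  rw [hvv] at hv
  refine ⟨v 0, v 1, ?_, C (C (MvPolynomial.eval ![v 0, v 1]
    (MvPolynomial.homogeneousComponent f.totalDegree f))⁻¹) * rotatedPoly f (v 0) (v 1), ?_, ?_⟩
  -- A form of positive degree vanishes at the origin, so the chosen direction is nonzero.
  · intro h
    have h0 : v 0 = 0 := congrArg Complex.re h
    have h1 : v 1 = 0 := congrArg Complex.im h
    refine hv ?_
    have hv0 : ![v 0, v 1] = 0 := by
      ext i
      fin_cases i <;> simp [h0, h1]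
    rw [hv0, MvPolynomial.eval_zero, MvPolynomial.constantCoeff_eq,
      MvPolynomial.coeff_homogeneousComponent, if_neg (by simpa using hf.ne)]
  · refine monic_of_natDegree_le_of_coeff_eq_one f.totalDegree
      ((natDegree_C_mul_le _ _).trans (natDegree_rotatedPoly_le _ _ _)) ?_
    rw [coeff_C_mul, coeff_rotatedPoly, ← C_mul, inv_mul_cancel₀ hv, C_1]
  · intro x y h
    rw [evalEval_mul, evalEval_rotatedPoly, h, mul_zero]

end Rotation

/-! ### Transport to rotated coordinates and conclusion. -/

lemma IsSeparating.preimage {E F : Type*} [TopologicalSpace E] [TopologicalSpace F] {S U V : Set F}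
    (h : IsSeparating S U V) (e : E ≃ₜ F) : IsSeparating (e ⁻¹' S) (e ⁻¹' U) (e ⁻¹' V) where
  isOpen_left := h.isOpen_left.preimage e.continuous
  isOpen_right := h.isOpen_right.preimage e.continuous
  disjoint := h.disjoint.preimage e
  eq_compl := by rw [h.eq_compl, Set.preimage_compl, Set.preimage_union]
  subset_left := by
    rw [← e.preimage_closure]
    exact Set.preimage_mono h.subset_left
  subset_right := by
    rw [← e.preimage_closure]
    exact Set.preimage_mono h.subset_right

/-- The linear coordinates on the plane in which `(x, y)` stands for `(y + x i) a`. -/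
noncomputable def rotatedCoordinates {a : ℂ} (ha : a ≠ 0) : (ℝ × ℝ) ≃L[ℝ] ℂ :=
  LinearEquiv.toContinuousLinearEquiv
    { toFun := fun v ↦ a * ⟨v.2, v.1⟩
      invFun := fun z ↦ ((a⁻¹ * z).im, (a⁻¹ * z).re)
      map_add' := fun v w ↦ by
        rw [← mul_add]
        rfl
      map_smul' := fun c v ↦ by
        rw [RingHom.id_apply, ← mul_smul_comm]
        congr 1
        apply Complex.ext <;> simp
      left_inv := fun v ↦ by simp [ha]
      right_inv := fun z ↦ mul_inv_cancel_left₀ ha z }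

/-- A set on a real algebraic curve that separates the plane locally is a piecewise smooth curve
with finitely many self-intersections, and has a tangent at all but finitely many points. -/
theorem IsSeparating.piecewise_smooth_of_algebraic {S U V : Set ℂ} (h : IsSeparating S U V)
    {f : MvPolynomial (Fin 2) ℝ} (hf : 0 < f.totalDegree)
    (hfS : ∀ z ∈ S, MvPolynomial.eval ![z.re, z.im] f = 0) :
    (∃ (h : ℕ) (γ : Fin h → SmoothPlaneArc),
      IsPiecewiseSmoothPresentation S γ ∧ (selfIntersections γ).Finite) ∧
    {z ∈ S | ¬ HasTangentLineAt S z}.Finite := by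
  obtain ⟨α, β, ha, p, hp, hpf⟩ := exists_rotation_monic hf
  obtain ⟨g, hg, hpg, u, v, d, hd, huv⟩ := exists_monic_separable p hp
  let L := rotatedCoordinates ha
  have hL := (h.preimage L.toHomeomorph).piecewise_smooth L hg
    (fun x hx ↦ hpg _ _ (hpf _ _ (by
      have h1 := hfS _ hx
      have h2 : L.toHomeomorph x = (⟨α, β⟩ : ℂ) * ⟨x.2, x.1⟩ := rfl
      rw [h2] at h1
      convert h1 using 3
      simp [add_comm]))) hd huv
  have hLS : L '' (L.toHomeomorph ⁻¹' S) = S := Set.image_preimage_eq S L.surjective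
  rw [hLS] at hL
  exact hL

theorem mainTheorem2 (m n : ℕ)
    (P : Fin (m + 1) → Matrix (Fin n) (Fin n) ℂ) (hP : (P (Fin.last m)).det ≠ 0)
    (w : Fin (m + 1) → ℝ) (hw : ∀ j, 0 ≤ w j) (hw0 : 0 < w 0)
    (ε : ℝ) (hε : 0 < ε) (hΛ : pseudospectrum P ε w ≠ Set.univ) :
    (∃ C : Set ℂ, IsRealAlgebraicPlaneCurve C ∧ frontier (pseudospectrum P ε w) ⊆ C) ∧
    (∃ (h : ℕ) (γ : Fin h → SmoothPlaneArc),
      IsPiecewiseSmoothPresentation (frontier (pseudospectrum P ε w)) γ ∧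
      (selfIntersections γ).Finite) ∧
    {z ∈ frontier (pseudospectrum P ε w) |
      ¬ HasTangentLineAt (frontier (pseudospectrum P ε w)) z}.Finite := by
  obtain ⟨f, hf, hfz⟩ := exists_polynomial_frontier_pseudospectrum hw hw0 hε hΛ
  exact ⟨⟨_, ⟨f, hf, rfl⟩, hfz⟩,
    (isSeparating_frontier_pseudospectrum hw hw0 hε).piecewise_smooth_of_algebraic hf hfz⟩
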